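/- **Theorem 2.10 (thN83, $c$-Deformed Polylogarithm Monodromy, Singular Case).** Let $X=\mathbb P^1(\mathbb C)\smallsetminus\{0,1,\infty\}$, and let $\tilde X$ be its universal cover, viewed as the set of homotopy classes $[\gamma]$ of paths $\gamma$ in $X$ starting at $-1$. In $\pi_1(X,-1)$ the product $\tau\tau'$ means: first follow $\tau$, then $\tau'$. For $\tau\in\pi_1(X,-1)$ and $F:\tilde X\to\mathbb C$ put $(Q_\tau F)([\gamma])=F([\tau\gamma])$. Let $[Z_0]$ be the class of a simple closed curve based at $-1$ that encloses $0$ once counterclockwise and does not meet $\{1-it:t\ge 0\}$, and let $[Z_1]$ be the class of a simple closed curve based at $-1$ that encloses $1$ once counterclockwise and does not meet $\{-it:t\ge 0\}$. Multivalued functions are continued analytically to $\tilde X$ from the half-disc $\{|z|<1,\ \operatorname{Im} z>0\}$, which has $-1$ on its boundary; $\log$ is the principal branch there, and $z^{1-c}=e^{(1-c)\log z}$. Fix an integer $m\ge 1$. For $c\in\mathbb C$ and $n\ge 0$ let $b_{n,c}(z)=\frac1{n!}z^{1-c}(\log z)^n$. For $c\in\mathbb C\smallsetminus\mathbb Z_{\le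 0}$ let $Li_m(z,c)=\sum_{n\ge 0}\frac{z^{n+1}}{(n+c)^m}$ and let $\mathcal B_{m+1,c}=(Li_m(z,c),\,b_{m-1,c},\,b_{m-2,c},\dots,b_{0,c})$. For an integer $k\ge0$ and $c=-k$ let $$Li^*_m(z,-k)=\sum_{n\ge 0,\ n\ne k}\frac{z^{n+1}}{(n-k)^m}+\frac1{m!}z^{k+1}(\log z)^m,$$ and let $\mathcal B^*_{m+1,-k}=(Li^*_m(z,-k),\,b_{m-1,-k},\,b_{m-2,-k},\dots,b_{0,-k})$. Then for every integer $k\ge 0$ and $c=-k$ the members of $\mathcal B^*_{m+1,-k}$ continue to linearly independent holomorphic functions on $\tilde X$ whose span is stable under all $Q_\tau$. Writing $B$ for the column vector of these functions, $Q_\tau B=\rho_{m,-k}(\tau)B$ determines a unique homomorphism $\rho_{m,-k}:\pi_1(X,-1)\to GL(m+1,\mathbb C)$. With indices $0\le i,j\le m$, $$\rho_{m,-k}([Z_0])_{ij}=\begin{cases}\dfrac{(2\pi i)^{j-i}}{(j-i)!}& i\le j,\\ 0& i>j\end{cases}$$ (where $2\pi i=2\pi\sqrt{-1}$), and $\rho_{m,-k}([Z_1])$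 is the identity matrix except for the additional entry $-2\pi i$ in row $0$, column $1$. The image of $\rho_{m,-k}$ is unipotent: $g-1$ is nilpotent for every $g$ in it. Moreover, for every $c\in\mathbb C\smallsetminus\mathbb Z_{\le0}$ the basis $\mathcal B_{m+1,c}$ determines in the same way a unique monodromy representation $\rho_{m,c}$, and the monodromy jumps discontinuously at $c=-k$: the limit of $\rho_{m,c}([Z_0])$ as $c\to-k$, $c\ne -k$, exists and is different from $\rho_{m,-k}([Z_0])$. -/

import Mathlib

open Filter Topology

namespace PolylogMonodromy

noncomputable section

/-- The thrice punctured sphere `ℙ¹(ℂ) ∖ {0, 1, ∞} = ℂ ∖ {0, 1}`. -/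
abbrev PuncturedPlane : Type := {z : ℂ // z ≠ 0 ∧ z ≠ 1}

/-- The base point `-1`. -/
def base : PuncturedPlane := ⟨-1, by norm_num, by norm_num⟩

/-- The universal cover of `ℂ ∖ {0, 1}` with base point `-1`: its points are the pairs consisting
of an endpoint `z` and a homotopy class (with fixed endpoints) of paths from `-1` to `z`. -/
abbrev UniversalCover : Type :=
  Σ z : PuncturedPlane, Path.Homotopic.Quotient base z

/-- The fundamental group `π₁(ℂ ∖ {0, 1}, -1)`, in which the product of `σ` and `τ` is
"first `σ`, then `τ`". Mathlib's `FundamentalGroup` multiplies loops in the other order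
(`p * q = q.trans p`), hence the opposite group. -/
abbrev LoopGroup : Type := (FundamentalGroup PuncturedPlane base)ᵐᵒᵖ

/-- The class in the fundamental group of a loop at `-1`. -/
def loopClass (γ : Path base base) : LoopGroup :=
  MulOpposite.op (FundamentalGroup.fromPath (Path.Homotopic.Quotient.mk γ))

/-- The translate `(Q_τ F)([γ]) = F([τ γ])` of a function on the universal cover,
where `τ γ` means: first follow `τ`, then `γ`. -/
def translate (τ : LoopGroup) (F : UniversalCover → ℂ) : UniversalCover → ℂ :=
  fun p => F ⟨p.1, (FundamentalGroup.toPath τ.unop).trans p.2⟩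

/-- Holomorphic functions on the universal cover, that is, multivalued analytic functions on
`ℂ ∖ {0, 1}`: near every point `[γ]` of the universal cover, the function is given by a holomorphic
function of the endpoint, when `γ` is prolonged by short paths. -/
def IsHolomorphic (F : UniversalCover → ℂ) : Prop :=
  ∀ p : UniversalCover, ∃ r : ℝ, 0 < r ∧ ∃ g : ℂ → ℂ,
    DifferentiableOn ℂ g (Metric.ball (p.1 : ℂ) r) ∧
      ∀ (w : PuncturedPlane) (δ : Path p.1 w),
        (∀ t, ((δ t : PuncturedPlane) : ℂ) ∈ Metric.ball (p.1 : ℂ) r) →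
          F ⟨w, p.2.trans (Path.Homotopic.Quotient.mk δ)⟩ = g (w : ℂ)

/-- `F` is the analytic continuation to the universal cover of the function `f`. Here `f` only
matters on the upper half `{|z| < 1, Im z > 0}` of the unit disc. The base point `-1` lies on
the boundary of this region (so the branch of the logarithm at the base point is
`log (-1) = π i`), and the region is embedded in the universal cover by means of the paths that
start at `-1` and move inside this region at all positive times. -/
def IsContinuation (f : ℂ → ℂ) (F : UniversalCover → ℂ) : Prop :=
  IsHolomorphic F ∧
    ∀ (z : PuncturedPlane) (γ : Path base z),
      (∀ t, 0 < t → ‖((γ t : PuncturedPlane) : ℂ)‖ < 1 ∧ 0 < ((γ t : PuncturedPlane) : ℂ).im) →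
        F ⟨z, Path.Homotopic.Quotient.mk γ⟩ = f (z : ℂ)

/-- `ρ` is the monodromy representation attached to the finite family `f`: the members of `f`
continue analytically to linearly independent multivalued functions `B i`, and the column
vector `B` is transformed as `Q_τ B = ρ(τ) B`. In particular the span of the `B i` is stable
under the action of the fundamental group. -/
def IsMonodromyRep {n : ℕ} (f : Fin n → ℂ → ℂ) (ρ : LoopGroup →* GL (Fin n) ℂ) : Prop :=
  ∃ B : Fin n → UniversalCover → ℂ,
    (∀ i, IsContinuation (f i) (B i)) ∧ LinearIndependent ℂ B ∧
      ∀ (τ : LoopGroup) (i : Fin n),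
        translate τ (B i) = ∑ j, ((ρ τ : GL (Fin n) ℂ) : Matrix (Fin n) (Fin n) ℂ) i j • B j

/-- The `c`-deformed polylogarithm `Li_m(z, c) = ∑ z ^ (n + 1) / (n + c) ^ m` in `|z| < 1`,
for `c` not in `{0, -1, -2, …}`. -/
def deformedPolylog (m : ℕ) (c z : ℂ) : ℂ :=
  ∑' n : ℕ, z ^ (n + 1) / ((n : ℂ) + c) ^ m

/-- The modified polylogarithm `Li*_m(z, -k)`, in `|z| < 1`. -/
def modifiedPolylog (m k : ℕ) (z : ℂ) : ℂ :=
  (∑' n : ℕ, if n = k then 0 else z ^ (n + 1) / ((n : ℂ) - (k : ℂ)) ^ m) +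
    1 / (m.factorial : ℂ) * z ^ (k + 1) * Complex.log z ^ m

/-- The function `(1 / n!) z ^ (1 - c) (log z) ^ n`, with principal branches. -/
def powerLog (n : ℕ) (c z : ℂ) : ℂ :=
  1 / (n.factorial : ℂ) * z ^ (1 - c) * Complex.log z ^ n

/-- The basis `Li_m(z, c), b_{m-1}, …, b_0`, where `b_n = (1 / n!) z ^ (1 - c) (log z) ^ n`. -/
def generalBasis (m : ℕ) (c : ℂ) (i : Fin (m + 1)) (z : ℂ) : ℂ :=
  if i = 0 then deformedPolylog m c z else powerLog (m - (i : ℕ)) c z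

/-- The modified basis `Li*_m(z, -k), b_{m-1}, …, b_0`, where
`b_n = (1 / n!) z ^ (1 - c) (log z) ^ n` and `c = -k`. -/
def modifiedBasis (m k : ℕ) (i : Fin (m + 1)) (z : ℂ) : ℂ :=
  if i = 0 then modifiedPolylog m k z else powerLog (m - (i : ℕ)) (-(k : ℂ)) z

theorem norm_exp_angle (t : ℝ) : ‖Complex.exp (2 * Real.pi * Complex.I * t)‖ = 1 := by
  rw [show (2 * Real.pi * Complex.I * t : ℂ) = ((2 * Real.pi * t : ℝ) : ℂ) * Complex.I by
    push_cast; ring]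
  exact Complex.norm_exp_ofReal_mul_I _

/-- The loop `Z₀`: the circle with centre `-1/4` and radius `3/4`, traversed once
counterclockwise from `-1`; it encloses `0` and does not meet `{1 - i t : t ≥ 0}`. -/
def circleFun (t : ℝ) : ℂ := -1 / 4 - 3 / 4 * Complex.exp (2 * Real.pi * Complex.I * t)

/-- The loop `Z₁`: a simple closed curve that starts at `-1`, encloses `1` once counterclockwise
and does not meet `{-i t : t ≥ 0}`. It is the image under `a ↦ exp (2 π i a)` of the circle with
centre `1/6` and radius `1/3`, traversed counterclockwise from `a = 1/2`; this circle lies in the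
strip `-1/6 ≤ Re a ≤ 1/2`, on which the map is injective, and encloses `a = 0` but no other
integer. -/
def aroundOneFun (t : ℝ) : ℂ :=
  Complex.exp (2 * Real.pi * Complex.I *
    (1 / 6 + 1 / 3 * Complex.exp (2 * Real.pi * Complex.I * t)))

theorem circleFun_mem (t : ℝ) : circleFun t ≠ 0 ∧ circleFun t ≠ 1 := by
  have h := norm_exp_angle t
  unfold circleFun
  generalize Complex.exp (2 * Real.pi * Complex.I * t) = e at h
  constructor
  · intro h0
    have he : e = ((-1 / 3 : ℝ) : ℂ) := by push_cast; linear_combination (-4 / 3 : ℂ) * h0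
    rw [he, Complex.norm_real] at h
    norm_num at h
  · intro h0
    have he : e = ((-5 / 3 : ℝ) : ℂ) := by push_cast; linear_combination (-4 / 3 : ℂ) * h0
    rw [he, Complex.norm_real] at h
    norm_num at h

theorem aroundOneFun_mem (t : ℝ) : aroundOneFun t ≠ 0 ∧ aroundOneFun t ≠ 1 := by
  have h := norm_exp_angle t
  unfold aroundOneFun
  generalize Complex.exp (2 * Real.pi * Complex.I * t) = e at h
  refine ⟨Complex.exp_ne_zero _, ?_⟩
  intro h1
  obtain ⟨n, hn⟩ := Complex.exp_eq_one_iff.mp h1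
  have hn' : (1 / 6 + 1 / 3 * e : ℂ) = n := by
    apply mul_left_cancel₀ Complex.two_pi_I_ne_zero
    rw [hn]; ring
  have he : e = ((3 * n - 1 / 2 : ℝ) : ℂ) := by push_cast; linear_combination 3 * hn'
  rw [he, Complex.norm_real, Real.norm_eq_abs] at h
  rcases (abs_eq (by norm_num : (0 : ℝ) ≤ 1)).mp h with h | h
  · have : (2 * n : ℤ) = 1 := by
      have : (2 * n : ℝ) = 1 := by linarith
      exact_mod_cast this
    omega
  · have : (6 * n : ℤ) = -1 := by
      have : (6 * n : ℝ) = -1 := by linarith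
      exact_mod_cast this
    omega

/-- The loop `Z₀` as a path in `ℂ ∖ {0, 1}`. -/
def pathZ0 : Path base base where
  toFun t := ⟨circleFun t, circleFun_mem t⟩
  continuous_toFun := by
    refine Continuous.subtype_mk ?_ _
    unfold circleFun
    fun_prop
  source' := by
    apply Subtype.ext
    simp only [circleFun, base]
    norm_num
  target' := by
    apply Subtype.ext
    simp only [circleFun, base]
    norm_num [Complex.exp_two_pi_mul_I]

/-- The loop `Z₁` as a path in `ℂ ∖ {0, 1}`. -/
def pathZ1 : Path base base where
  toFun t := ⟨aroundOneFun t, aroundOneFun_mem t⟩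
  continuous_toFun := by
    refine Continuous.subtype_mk ?_ _
    unfold aroundOneFun
    fun_prop
  source' := by
    apply Subtype.ext
    simp only [aroundOneFun, base]
    norm_num
    rw [show (2 * Real.pi * Complex.I * (1 / 2) : ℂ) = Real.pi * Complex.I by ring]
    exact Complex.exp_pi_mul_I
  target' := by
    apply Subtype.ext
    simp only [aroundOneFun, base]
    norm_num [Complex.exp_two_pi_mul_I]
    rw [show (2 * Real.pi * Complex.I * (1 / 2) : ℂ) = Real.pi * Complex.I by ring]
    exact Complex.exp_pi_mul_I

/-- The generator `[Z₀]` of the fundamental group. -/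
def Z0 : LoopGroup := loopClass pathZ0

/-- The generator `[Z₁]` of the fundamental group. -/
def Z1 : LoopGroup := loopClass pathZ1

/-- The upper unitriangular matrix with entries `(2 π i) ^ (j - i) / (j - i)!` for `i ≤ j`. -/
def matrixZ0 (m : ℕ) : Matrix (Fin (m + 1)) (Fin (m + 1)) ℂ :=
  Matrix.of fun i j =>
    if i ≤ j then
      (2 * Real.pi * Complex.I) ^ ((j : ℕ) - (i : ℕ)) / (((j : ℕ) - (i : ℕ)).factorial : ℂ)
    else 0

/-- The identity matrix with the additional entry `-2 π i` in the first row, second column. -/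
def matrixZ1 (m : ℕ) : Matrix (Fin (m + 1)) (Fin (m + 1)) ℂ :=
  Matrix.of fun i j =>
    if i = j then 1
    else if (i : ℕ) = 0 ∧ (j : ℕ) = 1 then -(2 * Real.pi * Complex.I)
    else 0

/-- A subgroup of `GL(n, ℂ)` is unipotent if `g - 1` is nilpotent for each of its elements `g`. -/
def IsUnipotentSubgroup {n : ℕ} (H : Subgroup (GL (Fin n) ℂ)) : Prop :=
  ∀ g ∈ H, IsNilpotent ((g : Matrix (Fin n) (Fin n) ℂ) - 1)

end

end PolylogMonodromy

/-! All the functions come from one triangular system of differential equations. Put `s 0 = log z`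
and `s j = z ^ (c - 1) Li_j`. Then `d (s 0) = dz / z`, `d (s 1) = z ^ (c - 1) dz / (1 - z)` and `d
(s (j + 2)) = s (j + 1) dz / z`. On a disc in `ℂ ∖ {0, 1}` a solution is determined by its values at
one point and can have any values there. The values therefore form a local system, hence a covering
space, and continuation along a homotopy class is the monodromy of this covering (`transport`).

The system has symmetries (`act`): shift `log z` by `ω`, multiply the other components by `exp ((c -
1) ω)`, and add combinations of `(log z) ^ n / n!`. They commute with transport (`transport_act`)
and act transitively on states (`exists_act_eq`). So a loop moves the base state by a symmetry, and
this symmetry gives a matrix on the functions `Li_m, b_{m-1}, …, b_0` (`readout_act`,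
`translate_coverBasis`).

Two explicit solutions give the two matrices. For `Z₀`, use `w = log z` and the power series. If `c
= -k`, the resonant term of the geometric series integrates to powers of `w`, which is the
logarithmic term of `Li*`; `eps c` switches it on, and `w ↦ w + 2 π i` gives the symmetry
(`transport_pathZ0`). For `Z₁`, use `v = log (log z)`: the form `z ^ (c - 1) dz / (1 - z)` has
residue `-1` at `z = 1`, so the solution is holomorphic in `u = log z` apart from the terms `-v u ^
j / j!` (`transport_pathZ1`).

Independence follows by applying `Z₁` to a linear relation, which isolates the coefficient of
`Li_m`; what remains is a polynomial in `log z`. Uniqueness of the representation rests on the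
identity theorem on the universal cover. At `c = -k` the factor `exp ((1 - c) ω)` is `1` for `ω ∈ 2
π i ℤ`, so every matrix is upper unitriangular. The jump comes from `eps`, which is `1` at `-k` and
`0` at nearby points. -/

namespace PolylogMonodromy

noncomputable section

/-! ### Local systems and parallel transport -/

/-- A local system of sets on `X` with fibre `E`, given by parallel transport
`T a x y` from `x` to `y` inside an open neighbourhood `U a` of `a`. -/
structure FlatSystem (X E : Type*) [TopologicalSpace X] where
  U : X → Set X
  isOpen_U : ∀ a, IsOpen (U a)
  mem_U : ∀ a, a ∈ U a
  T : X → X → X → E → E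
  T_self : ∀ a x v, x ∈ U a → T a x x v = v
  T_trans : ∀ a x y z v, x ∈ U a → y ∈ U a → z ∈ U a → T a y z (T a x y v) = T a x z v
  T_compat : ∀ a b x y v, x ∈ U a → y ∈ U a → x ∈ U b → y ∈ U b → T a x y v = T b x y v

namespace FlatSystem

variable {X E : Type*} [TopologicalSpace X] [TopologicalSpace E] [DiscreteTopology E]
  (S : FlatSystem X E)

/-- A family of vectors along a path which is locally parallel. -/
def IsFlat {x y : X} (γ : Path x y) (σ : unitInterval → E) : Prop :=
  ∀ t₀, ∀ᶠ t in 𝓝 t₀, σ t = S.T (γ t₀) (γ t₀) (γ t) (σ t₀)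

/-- The fibre bundle with discrete fibre attached to a local system. -/
def core : FiberBundleCore X X E where
  baseSet := S.U
  isOpen_baseSet := S.isOpen_U
  indexAt := id
  mem_baseSet_at := S.mem_U
  -- The chart of `a` records a vector by its transport to the centre `a`. As `indexAt` is the
  -- identity, a point of the total space over `x` is stored as a vector at `x` itself.
  coordChange a b x v := S.T b x b (S.T a a x v)
  coordChange_self a x hx v := by
    rw [S.T_trans a a x a v (S.mem_U a) hx (S.mem_U a), S.T_self a a v (S.mem_U a)]
  continuousOn_coordChange a b := by
    rintro ⟨x, v⟩ ⟨hx, -⟩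
    have hc : ContinuousOn (fun p : X × E => S.T b x b (S.T a a x p.2))
        ((S.U a ∩ S.U b) ×ˢ Set.univ) :=
      (continuous_of_discreteTopology (f := fun v : E => S.T b x b (S.T a a x v))).comp
        continuous_snd |>.continuousOn
    refine (hc.congr ?_) (x, v) ⟨hx, trivial⟩
    rintro ⟨y, u⟩ ⟨hy, -⟩
    dsimp only at hy ⊢
    rw [← S.T_trans a a x y u (S.mem_U a) hx.1 hy.1,
      S.T_compat a b x y _ hx.1 hy.1 hx.2 hy.2,
      S.T_trans b x y b _ hx.2 hy.2 (S.mem_U b)]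
  coordChange_comp a b c x hx v := by
    obtain ⟨⟨ha, hb⟩, hc⟩ := hx
    rw [S.T_trans b x b x _ hb (S.mem_U b) hb, S.T_self b x _ hb]

theorem isCoveringMap : IsCoveringMap S.core.proj :=
  FiberBundle.isCoveringMap (F := E) (E := S.core.Fiber)

/-- Parallel transport along a homotopy class of paths. -/
def transport {x y : X} (γ : Path.Homotopic.Quotient x y) (v : E) : E :=
  (S.isCoveringMap.monodromy γ ⟨⟨x, v⟩, rfl⟩).1.2

/-- A vector over `x`, as a point of the fibre of the covering. -/
def point (x : X) (v : E) : S.core.proj ⁻¹' {x} := ⟨⟨x, v⟩, rfl⟩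

theorem monodromy_point {x y : X} (γ : Path.Homotopic.Quotient x y) (v : E) :
    S.isCoveringMap.monodromy γ (S.point x v) = S.point y (S.transport γ v) := by
  have key : ∀ e : S.core.proj ⁻¹' {y}, e = S.point y e.1.2 := by
    rintro ⟨⟨z, u⟩, h⟩
    obtain rfl : z = y := h
    rfl
  exact key _

theorem transport_refl (x : X) (v : E) :
    S.transport (Path.Homotopic.Quotient.refl x) v = v := by
  unfold transport
  rw [IsCoveringMap.monodromy_refl]
  rfl

theorem transport_trans {x y z : X} (γ : Path.Homotopic.Quotient x y)
    (γ' : Path.Homotopic.Quotient y z) (v : E) :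
    S.transport (γ.trans γ') v = S.transport γ' (S.transport γ v) := by
  conv_lhs => unfold transport
  rw [IsCoveringMap.monodromy_trans_apply]
  have := S.monodromy_point γ v
  unfold point at this
  rw [this]
  rfl

/-- Since the fibre is discrete, continuity at `t₀` means that the coordinate in the chart centred
at `γ t₀` is locally constant. -/
theorem continuousAt_lift_iff {x y : X} (γ : Path x y) (σ : unitInterval → E) (t₀ : unitInterval) :
    ContinuousAt (fun t => (⟨γ t, σ t⟩ : S.core.TotalSpace)) t₀ ↔
      ∀ᶠ t in 𝓝 t₀, S.T (γ t₀) (γ t) (γ t₀) (σ t) = σ t₀ := by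
  have hself := S.T_self (γ t₀) (γ t₀) (σ t₀) (S.mem_U _)
  have hγ : ∀ᶠ t in 𝓝 t₀, γ t ∈ S.U (γ t₀) :=
    γ.continuous.continuousAt.eventually ((S.isOpen_U _).mem_nhds (S.mem_U _))
  rw [FiberBundle.continuousAt_totalSpace]
  have h1 : ∀ t, ((trivializationAt E S.core.Fiber (γ t₀)) (⟨γ t, σ t⟩ : S.core.TotalSpace)).2 =
      S.T (γ t₀) (γ t) (γ t₀) (S.T (γ t) (γ t) (γ t) (σ t)) := fun t => rfl
  simp only [h1, S.T_self _ _ _ (S.mem_U _)]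
  constructor
  · rintro ⟨-, h⟩
    have := h.eventually (by rw [nhds_discrete]; exact mem_pure.mpr (Set.mem_singleton _))
    filter_upwards [this] with t ht
    rw [← hself]; exact ht
  · intro h
    refine ⟨γ.continuous.continuousAt, ?_⟩
    have h2 : (fun t => S.T (γ t₀) (γ t) (γ t₀) (σ t)) =ᶠ[𝓝 t₀] fun _ => σ t₀ := h
    exact (continuousAt_congr h2).mpr continuousAt_const

theorem isFlat_iff_continuous {x y : X} (γ : Path x y) (σ : unitInterval → E) :
    S.IsFlat γ σ ↔ Continuous (fun t => (⟨γ t, σ t⟩ : S.core.TotalSpace)) := by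
  rw [continuous_iff_continuousAt]
  refine forall_congr' fun t₀ => ?_
  rw [continuousAt_lift_iff]
  have hγ : ∀ᶠ t in 𝓝 t₀, γ t ∈ S.U (γ t₀) :=
    γ.continuous.continuousAt.eventually ((S.isOpen_U _).mem_nhds (S.mem_U _))
  have h0 := S.mem_U (γ t₀)
  constructor
  · intro h
    filter_upwards [h, hγ] with t ht hm
    rw [ht, S.T_trans _ _ _ _ _ h0 hm h0, S.T_self _ _ _ h0]
  · intro h
    filter_upwards [h, hγ] with t ht hm
    rw [← ht, S.T_trans _ _ _ _ _ hm h0 hm, S.T_self _ _ _ hm]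

/-- The vector part of a point of the total space. -/
def vec (e : S.core.TotalSpace) : E := e.2

theorem mk_vec (e : S.core.TotalSpace) (z : X) (h : e.proj = z) :
    (⟨z, S.vec e⟩ : S.core.TotalSpace) = e := by
  obtain ⟨w, u⟩ := e
  obtain rfl : w = z := h
  rfl

/-- A flat family is a continuous lift to the covering, and lifts with a given start are unique.
This is how explicit solutions compute transport. -/
theorem transport_of_isFlat {x y : X} (γ : Path x y) (σ : unitInterval → E)
    (h : S.IsFlat γ σ) : S.transport (Path.Homotopic.Quotient.mk γ) (σ 0) = σ 1 := by
  rw [isFlat_iff_continuous] at h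
  have hs : (⟨γ 0, σ 0⟩ : S.core.TotalSpace) = ⟨x, σ 0⟩ :=
    S.mk_vec ⟨x, σ 0⟩ (γ 0) γ.source.symm
  have key := (S.isCoveringMap.eq_liftPath_iff (γ := γ.toContinuousMap)
    (e := ⟨x, σ 0⟩) (γ_0 := γ.source) (Γ := fun t => (⟨γ t, σ t⟩ : S.core.TotalSpace))).mpr
    ⟨h, rfl, hs⟩
  exact (congrArg S.vec (congr_fun key 1)).symm

theorem exists_isFlat {x y : X} (γ : Path x y) (v : E) :
    ∃ σ : unitInterval → E, S.IsFlat γ σ ∧ σ 0 = v ∧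
      σ 1 = S.transport (Path.Homotopic.Quotient.mk γ) v := by
  have h1 : ∀ t, (S.isCoveringMap.liftPath γ.toContinuousMap ⟨x, v⟩ γ.source t).proj = γ t :=
    fun t => congr_fun (S.isCoveringMap.liftPath_lifts γ.toContinuousMap ⟨x, v⟩ γ.source) t
  have h0 : S.isCoveringMap.liftPath γ.toContinuousMap ⟨x, v⟩ γ.source 0 = ⟨x, v⟩ :=
    S.isCoveringMap.liftPath_zero _ _ _
  refine ⟨fun t => S.vec (S.isCoveringMap.liftPath γ.toContinuousMap ⟨x, v⟩ γ.source t),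
    (S.isFlat_iff_continuous γ _).mpr ?_, congrArg S.vec h0, rfl⟩
  have h2 := funext fun t => S.mk_vec _ _ (h1 t)
  exact h2 ▸ (S.isCoveringMap.liftPath γ.toContinuousMap ⟨x, v⟩ γ.source).continuous

theorem transport_injective {x y : X} (γ : Path.Homotopic.Quotient x y) :
    Function.Injective (S.transport γ) := by
  intro u v h
  have := S.isCoveringMap.monodromy_bijective γ
  have h2 : S.point x u = S.point x v := this.1 (by rw [monodromy_point, monodromy_point, h])
  have h3 := congrArg Subtype.val h2
  unfold point at h3
  injection h3

end FlatSystem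
-- The differential system of the polylogarithms
/-- Iterated primitives on a disc with prescribed values at a point. -/
theorem exists_primitive_chain {a x : ℂ} {r : ℝ} (G : ℕ → (ℂ → ℂ) → ℂ → ℂ)
    (hG : ∀ n f, DifferentiableOn ℂ f (Metric.ball a r) →
      DifferentiableOn ℂ (G n f) (Metric.ball a r))
    (f₀ : ℂ → ℂ) (hf₀ : DifferentiableOn ℂ f₀ (Metric.ball a r)) (v : ℕ → ℂ) :
    ∃ s : ℕ → ℂ → ℂ, s 0 = f₀ ∧ ∀ n, s (n + 1) x = v n ∧
      ∀ z ∈ Metric.ball a r, HasDerivAt (s (n + 1)) (G n (s n) z) z := by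
  have step : ∀ n (f : {f : ℂ → ℂ // DifferentiableOn ℂ f (Metric.ball a r)}),
      ∃ F : {f : ℂ → ℂ // DifferentiableOn ℂ f (Metric.ball a r)}, F.1 x = v n ∧
        ∀ z ∈ Metric.ball a r, HasDerivAt F.1 (G n f.1 z) z := by
    intro n f
    obtain ⟨F, hF⟩ := (hG n f.1 f.2).isExactOn_ball.with_val_at x (v n)
    exact ⟨⟨F, fun z hz => (hF.2 z hz).differentiableAt.differentiableWithinAt⟩, hF.1, hF.2⟩
  choose F hF using step
  let s : ℕ → {f : ℂ → ℂ // DifferentiableOn ℂ f (Metric.ball a r)} :=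
    fun n => Nat.rec ⟨f₀, hf₀⟩ F n
  exact ⟨fun n => (s n).1, rfl, fun n => hF n (s n)⟩

/-- The differential system of the polylogarithms in a coordinate `w` with `z = φ w`: the
unknown functions are `s 0 = log z` and `s j = z ^ (c - 1) Li_j`. Here `φ'` is the derivative
of `φ`. -/
structure IsSol (c : ℂ) (φ φ' : ℂ → ℂ) (s : ℕ → ℂ → ℂ) (W : Set ℂ) : Prop where
  zero : ∀ w ∈ W, HasDerivAt (s 0) (φ' w / φ w) w
  one : ∀ w ∈ W, HasDerivAt (s 1) (Complex.exp ((c - 1) * s 0 w) * φ' w / (1 - φ w)) w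
  succ : ∀ j, ∀ w ∈ W, HasDerivAt (s (j + 2)) (s (j + 1) w * φ' w / φ w) w

namespace IsSol

variable {c : ℂ} {φ φ' : ℂ → ℂ} {s s' : ℕ → ℂ → ℂ} {W : Set ℂ}

theorem mono (h : IsSol c φ φ' s W) {V : Set ℂ} (hV : V ⊆ W) : IsSol c φ φ' s V :=
  ⟨fun w hw => h.zero w (hV hw), fun w hw => h.one w (hV hw), fun j w hw => h.succ j w (hV hw)⟩

/-- The system is triangular: once one component agrees, the next has the same derivative and the
same value at `x`. -/
theorem eqOn (h : IsSol c φ φ' s W) (h' : IsSol c φ φ' s' W) (hW : IsOpen W)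
    (hc : IsPreconnected W) {x : ℂ} (hx : x ∈ W) (he : ∀ j, s j x = s' j x) (j : ℕ) :
    Set.EqOn (s j) (s' j) W := by
  have aux : ∀ {f g d e : ℂ → ℂ}, (∀ w ∈ W, HasDerivAt f (d w) w) →
      (∀ w ∈ W, HasDerivAt g (e w) w) → (∀ w ∈ W, d w = e w) → f x = g x → Set.EqOn f g W := by
    intro f g d e hf hg hde hfg
    refine hW.eqOn_of_deriv_eq hc (fun w hw => (hf w hw).differentiableAt.differentiableWithinAt)
      (fun w hw => (hg w hw).differentiableAt.differentiableWithinAt) (fun w hw => ?_) hx hfg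
    rw [(hf w hw).deriv, (hg w hw).deriv, hde w hw]
  have h0 : Set.EqOn (s 0) (s' 0) W := aux h.zero h'.zero (fun _ _ => rfl) (he 0)
  have hs : ∀ j, Set.EqOn (s (j + 1)) (s' (j + 1)) W := by
    intro j
    induction j with
    | zero => exact aux h.one h'.one (fun w hw => by rw [h0 hw]) (he 1)
    | succ j ih => exact aux (h.succ j) (h'.succ j) (fun w hw => by rw [ih hw]) (he _)
  cases j with
  | zero => exact h0
  | succ j => exact hs j

theorem comp (h : IsSol c id 1 s W) {V : Set ℂ} (hφ : ∀ w ∈ V, HasDerivAt φ (φ' w) w)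
    (hm : ∀ w ∈ V, φ w ∈ W) : IsSol c φ φ' (fun j w => s j (φ w)) V := by
  refine ⟨fun w hw => ?_, fun w hw => ?_, fun j w hw => ?_⟩
  · refine ((h.zero _ (hm w hw)).comp w (hφ w hw)).congr_deriv ?_
    simp [div_eq_inv_mul]
  · refine ((h.one _ (hm w hw)).comp w (hφ w hw)).congr_deriv ?_
    simp; ring
  · refine ((h.succ j _ (hm w hw)).comp w (hφ w hw)).congr_deriv ?_
    simp; ring

theorem exists_ball {a x : ℂ} {r : ℝ} (hW : ∀ z ∈ Metric.ball a r, z ≠ 0 ∧ z ≠ 1)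
    (v : ℕ → ℂ) : ∃ s, IsSol c id 1 s (Metric.ball a r) ∧ ∀ j, s j x = v j := by
  have h1 : DifferentiableOn ℂ (fun z : ℂ => 1 / z) (Metric.ball a r) := fun z hz =>
    ((differentiableAt_const _).div differentiableAt_id (hW z hz).1).differentiableWithinAt
  obtain ⟨ℓ, hℓx, hℓ⟩ := h1.isExactOn_ball.with_val_at x (v 0)
  obtain ⟨s, hs0, hs⟩ := exists_primitive_chain (a := a) (x := x) (r := r)
    (fun n f z => if n = 0 then Complex.exp ((c - 1) * f z) / (1 - z) else f z / z) (by
      intro n f hf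
      by_cases hn : n = 0
      · simp only [hn, if_true]
        refine DifferentiableOn.div ((hf.const_mul _).cexp) (by fun_prop) ?_
        intro z hz h
        exact (hW z hz).2 (sub_eq_zero.mp h).symm
      · simp only [hn, if_false]
        exact hf.div differentiableOn_id fun z hz => (hW z hz).1)
    ℓ (fun z hz => (hℓ z hz).differentiableAt.differentiableWithinAt) (fun n => v (n + 1))
  refine ⟨s, ⟨fun z hz => ?_, fun z hz => ?_, fun j z hz => ?_⟩, fun j => ?_⟩
  · rw [hs0]; simpa using hℓ z hz
  · simpa using (hs 0).2 z hz
  · simpa using (hs (j + 1)).2 z hz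
  · cases j with
    | zero => rw [hs0]; exact hℓx
    | succ j => exact (hs j).1

end IsSol

/-! ### The local system of solutions and its transport -/

/-- States of the differential system, with the discrete topology. -/
@[ext] structure State where
  /-- The components of a state. -/
  val : ℕ → ℂ

instance : TopologicalSpace State := ⊥

instance : DiscreteTopology State := ⟨rfl⟩

/-- The distance from `a` to `{0, 1}`. -/
def rad (a : PuncturedPlane) : ℝ := min ‖(a : ℂ)‖ ‖(a : ℂ) - 1‖

theorem rad_pos (a : PuncturedPlane) : 0 < rad a :=
  lt_min (norm_pos_iff.mpr a.2.1) (norm_pos_iff.mpr (sub_ne_zero.mpr a.2.2))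

/-- The largest disc around `a` in `ℂ ∖ {0, 1}`. -/
def disc (a : PuncturedPlane) : Set ℂ := Metric.ball (a : ℂ) (rad a)

theorem isOpen_disc (a : PuncturedPlane) : IsOpen (disc a) := Metric.isOpen_ball

theorem mem_disc_self (a : PuncturedPlane) : (a : ℂ) ∈ disc a := Metric.mem_ball_self (rad_pos a)

theorem ne_of_mem_disc {a : PuncturedPlane} {z : ℂ} (h : z ∈ disc a) : z ≠ 0 ∧ z ≠ 1 := by
  rw [disc, Metric.mem_ball, dist_comm, dist_eq_norm, rad, lt_min_iff] at h
  constructor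
  · rintro rfl; simp at h
  · rintro rfl; simp at h

theorem convex_disc (a : PuncturedPlane) : Convex ℝ (disc a) := convex_ball _ _

/-- A solution in the disc around `a` with value `v` at `x`. -/
def localSol (c : ℂ) (a : PuncturedPlane) (x : ℂ) (v : ℕ → ℂ) : ℕ → ℂ → ℂ :=
  (IsSol.exists_ball (c := c) (x := x) (fun _ hz => ne_of_mem_disc (a := a) hz) v).choose

theorem isSol_localSol (c : ℂ) (a : PuncturedPlane) (x : ℂ) (v : ℕ → ℂ) :
    IsSol c id 1 (localSol c a x v) (disc a) :=
  (IsSol.exists_ball (c := c) (x := x) (fun _ hz => ne_of_mem_disc (a := a) hz) v).choose_spec.1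

theorem localSol_self (c : ℂ) (a : PuncturedPlane) (x : ℂ) (v : ℕ → ℂ) (j : ℕ) :
    localSol c a x v j x = v j :=
  (IsSol.exists_ball (c := c) (x := x) (fun _ hz => ne_of_mem_disc (a := a) hz) v).choose_spec.2 j

/-- The intersection of two convex sets is connected, so uniqueness applies there. This yields both
the cocycle rule and the independence of the disc. -/
theorem localSol_eq {c : ℂ} {a : PuncturedPlane} {s : ℕ → ℂ → ℂ} {W : Set ℂ}
    (h : IsSol c id 1 s W) (hW : IsOpen W) (hc : Convex ℝ W) {x y : ℂ} (hx : x ∈ disc a)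
    (hy : y ∈ disc a) (hxW : x ∈ W) (hyW : y ∈ W) {v : ℕ → ℂ} (hv : ∀ j, s j x = v j) (j : ℕ) :
    localSol c a x v j y = s j y :=
  ((isSol_localSol c a x v).mono Set.inter_subset_left).eqOn (h.mono Set.inter_subset_right)
    ((isOpen_disc a).inter hW) ((convex_disc a).inter hc).isPreconnected (x := x) ⟨hx, hxW⟩
    (fun j => by rw [localSol_self, hv]) j ⟨hy, hyW⟩

/-- The local system of solutions of the differential system of the polylogarithms. -/
def polylogSystem (c : ℂ) : FlatSystem PuncturedPlane State where
  U a := {x | (x : ℂ) ∈ disc a}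
  isOpen_U a := (isOpen_disc a).preimage continuous_subtype_val
  mem_U := mem_disc_self
  T a x y v := ⟨fun j => localSol c a x v.val j y⟩
  T_self a x v _ := State.ext (funext fun j => localSol_self c a x v.val j)
  T_trans a x _ _ v _ hy hz := State.ext <| funext fun j =>
    localSol_eq (isSol_localSol c a x v.val) (isOpen_disc a) (convex_disc a) hy hz hy hz
      (fun _ => rfl) j
  T_compat _ b x _ v hxa hya hxb hyb := State.ext <| funext fun j =>
    localSol_eq (isSol_localSol c b x v.val) (isOpen_disc b) (convex_disc b) hxa hya hxb hyb
      (localSol_self c b x v.val) j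

/-- A solution in a coordinate `w` with `z = φ w` becomes single valued along a lifted path, even
when it is multivalued in `z`. It is used below with `φ = exp` and `φ = exp ∘ exp`. -/
theorem isFlat_of_sol {c : ℂ} {φ φ' : ℂ → ℂ} {V : Set ℂ} (hV : IsOpen V) {s : ℕ → ℂ → ℂ}
    (hs : IsSol c φ φ' s V) (hφ : ∀ w ∈ V, HasDerivAt φ (φ' w) w)
    {x y : PuncturedPlane} (γ : Path x y) (w : unitInterval → ℂ) (hw : Continuous w)
    (hwV : ∀ t, w t ∈ V) (hγ : ∀ t, φ (w t) = γ t) :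
    (polylogSystem c).IsFlat γ (fun t => ⟨fun j => s j (w t)⟩) := by
  intro t₀
  have hd : V ∩ φ ⁻¹' disc (γ t₀) ∈ 𝓝 (w t₀) := by
    refine inter_mem (hV.mem_nhds (hwV t₀)) ?_
    refine (hφ _ (hwV t₀)).continuousAt.preimage_mem_nhds ((isOpen_disc _).mem_nhds ?_)
    rw [hγ]; exact mem_disc_self _
  obtain ⟨r, hr, hball⟩ := Metric.mem_nhds_iff.mp hd
  have h1 : IsSol c φ φ' (fun j u => localSol c (γ t₀) (γ t₀) (fun j => s j (w t₀)) j (φ u))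
      (Metric.ball (w t₀) r) :=
    (isSol_localSol c (γ t₀) (γ t₀) _).comp (fun u hu => hφ u (hball hu).1)
      (fun u hu => (hball hu).2)
  have h2 := (hs.mono fun u hu => (hball hu).1).eqOn h1 Metric.isOpen_ball
    (convex_ball _ _).isPreconnected (Metric.mem_ball_self hr)
    (fun j => by rw [hγ, localSol_self])
  filter_upwards [hw.continuousAt.preimage_mem_nhds (Metric.ball_mem_nhds (w t₀) hr)] with t ht
  refine State.ext (funext fun j => ?_)
  exact (h2 j ht).trans (by beta_reduce; rw [hγ]; rfl)

theorem transport_of_sol {c : ℂ} {φ φ' : ℂ → ℂ} {V : Set ℂ} (hV : IsOpen V) {s : ℕ → ℂ → ℂ}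
    (hs : IsSol c φ φ' s V) (hφ : ∀ w ∈ V, HasDerivAt φ (φ' w) w)
    {x y : PuncturedPlane} (γ : Path x y) (w : unitInterval → ℂ) (hw : Continuous w)
    (hwV : ∀ t, w t ∈ V) (hγ : ∀ t, φ (w t) = γ t) :
    (polylogSystem c).transport (Path.Homotopic.Quotient.mk γ) ⟨fun j => s j (w 0)⟩ =
      ⟨fun j => s j (w 1)⟩ :=
  (polylogSystem c).transport_of_isFlat γ _ (isFlat_of_sol hV hs hφ γ w hw hwV hγ)

theorem eq_of_hasDerivAt_zero {f : ℂ → ℂ} {W : Set ℂ} (hW : IsOpen W) (hc : IsPreconnected W)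
    (hf : ∀ z ∈ W, HasDerivAt f 0 z) {x y : ℂ} (hx : x ∈ W) (hy : y ∈ W) : f x = f y :=
  hW.is_const_of_deriv_eq_zero hc
    (fun z hz => (hf z hz).differentiableAt.differentiableWithinAt)
    (fun z hz => (hf z hz).deriv) hx hy

theorem eq_of_eventually_eq {E : Type*} (f : unitInterval → E)
    (h : ∀ t₀, ∀ᶠ t in 𝓝 t₀, f t = f t₀) : f 0 = f 1 := by
  have h1 : IsLocallyConstant f := (IsLocallyConstant.iff_eventually_eq f).mpr h
  exact h1.apply_eq_of_isPreconnected isPreconnected_univ (Set.mem_univ _) (Set.mem_univ _)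

/-- Parallel transport of states. -/
def transport (c : ℂ) {x y : PuncturedPlane} (γ : Path.Homotopic.Quotient x y) (v : State) :
    State := (polylogSystem c).transport γ v

theorem transport_trans (c : ℂ) {x y z : PuncturedPlane} (γ : Path.Homotopic.Quotient x y)
    (γ' : Path.Homotopic.Quotient y z) (v : State) :
    transport c (γ.trans γ') v = transport c γ' (transport c γ v) :=
  (polylogSystem c).transport_trans γ γ' v

theorem transport_injective (c : ℂ) {x y : PuncturedPlane} (γ : Path.Homotopic.Quotient x y) :
    Function.Injective (transport c γ) :=
  (polylogSystem c).transport_injective γ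

/-- The product `exp (-s 0) * z` has derivative zero, so a logarithm stays a logarithm along the
path. -/
theorem exp_transport (c : ℂ) {x y : PuncturedPlane} (γ : Path.Homotopic.Quotient x y)
    (v : State) (hv : Complex.exp (v.val 0) = x) :
    Complex.exp ((transport c γ v).val 0) = y := by
  obtain ⟨γ⟩ := γ
  obtain ⟨τ, hτ, h0, h1⟩ := (polylogSystem c).exists_isFlat γ v
  have key := eq_of_eventually_eq (fun t => Complex.exp (-(τ t).val 0) * (γ t : ℂ)) (by
    intro t₀
    have hm : ∀ᶠ t in 𝓝 t₀, (γ t : ℂ) ∈ disc (γ t₀) :=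
      γ.continuous.continuousAt.eventually
        (((polylogSystem c).isOpen_U _).mem_nhds ((polylogSystem c).mem_U _))
    filter_upwards [hτ t₀, hm] with t ht hmt
    rw [ht]
    have hs := isSol_localSol c (γ t₀) (γ t₀) (τ t₀).val
    have := eq_of_hasDerivAt_zero (isOpen_disc (γ t₀)) (convex_disc (γ t₀)).isPreconnected
      (f := fun z => Complex.exp (-(localSol c (γ t₀) (γ t₀) (τ t₀).val 0 z)) * z) (by
        intro z hz
        refine (((hs.zero z hz).neg.cexp).mul (hasDerivAt_id z)).congr_deriv ?_
        have := (ne_of_mem_disc hz).1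
        simp only [id, Pi.one_apply, Pi.neg_apply]
        field_simp
        ring) hmt (mem_disc_self _)
    rw [localSol_self] at this
    exact this)
  simp only [h0, Path.source, Path.target, Complex.exp_neg, hv] at key
  have e1 := Complex.exp_ne_zero ((τ 1).val 0)
  rw [inv_mul_cancel₀ x.2.1] at key
  field_simp at key
  rw [h1] at key
  exact key

theorem transport_val_zero (c : ℂ) {x y : PuncturedPlane} (γ : Path x y) (v : State)
    (w : unitInterval → ℂ) (hw : Continuous w) (hγ : ∀ t, Complex.exp (w t) = γ t) :
    (transport c (Path.Homotopic.Quotient.mk γ) v).val 0 = v.val 0 + w 1 - w 0 := by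
  obtain ⟨τ, hτ, h0, h1⟩ := (polylogSystem c).exists_isFlat γ v
  have key := eq_of_eventually_eq (fun t => (τ t).val 0 - w t) (by
    intro t₀
    have hd : Complex.exp ⁻¹' disc (γ t₀) ∈ 𝓝 (w t₀) := by
      refine Complex.continuous_exp.continuousAt.preimage_mem_nhds
        ((isOpen_disc _).mem_nhds ?_)
      rw [hγ]; exact mem_disc_self _
    obtain ⟨r, hr, hball⟩ := Metric.mem_nhds_iff.mp hd
    have hs : IsSol c Complex.exp Complex.exp _ (Metric.ball (w t₀) r) :=
      (isSol_localSol c (γ t₀) (γ t₀) (τ t₀).val).comp (fun u _ => Complex.hasDerivAt_exp u)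
        (fun u hu => hball hu)
    filter_upwards [hτ t₀, hw.continuousAt.preimage_mem_nhds (Metric.ball_mem_nhds (w t₀) hr)]
      with t ht hmt
    have := eq_of_hasDerivAt_zero Metric.isOpen_ball (convex_ball _ _).isPreconnected
      (f := fun u => localSol c (γ t₀) (γ t₀) (τ t₀).val 0 (Complex.exp u) - u) (by
        intro u hu
        refine ((hs.zero u hu).sub (hasDerivAt_id u)).congr_deriv ?_
        rw [div_self (Complex.exp_ne_zero u), sub_self]) hmt (Metric.mem_ball_self hr)
    rw [hγ, hγ, localSol_self] at this
    rw [ht]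
    exact this)
  simp only [h0, h1] at key
  unfold transport
  linear_combination -key

/-! ### Symmetries of the system -/

/-- The symmetries of the differential system: `log z` is shifted by `ω`, and multiples of
`(log z) ^ n / n!` are added to the remaining components. -/
def act (c ω : ℂ) (a : ℕ → ℂ) (v : State) : State where
  val
  | 0 => v.val 0 + ω
  | j + 1 => Complex.exp ((c - 1) * ω) * v.val (j + 1) +
      ∑ r ∈ Finset.range (j + 1), a r * (v.val 0 ^ (j - r) / ((j - r).factorial : ℂ))

theorem hasDerivAt_pow_div_factorial {f : ℂ → ℂ} {f' z : ℂ} (hf : HasDerivAt f f' z) (n : ℕ) :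
    HasDerivAt (fun w => f w ^ (n + 1) / ((n + 1).factorial : ℂ))
      (f z ^ n / (n.factorial : ℂ) * f') z := by
  refine ((hf.pow (n + 1)).div_const _).congr_deriv ?_
  have h1 : (n.factorial : ℂ) ≠ 0 := by exact_mod_cast n.factorial_ne_zero
  have h2 : ((n : ℂ) + 1) ≠ 0 := by exact_mod_cast n.succ_ne_zero
  rw [Nat.factorial_succ]
  push_cast
  field_simp

/-- Shifting `s 0` multiplies the source term of `s 1` by `exp ((c - 1) ω)`. The added terms solve
the homogeneous equations, because the derivative of `s 0 ^ (n + 1) / (n + 1)!` is `s 0 ^ n / n!`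
times that of `s 0`. -/
theorem IsSol.act {c : ℂ} {φ φ' : ℂ → ℂ} {s : ℕ → ℂ → ℂ} {W : Set ℂ} (h : IsSol c φ φ' s W)
    (ω : ℂ) (a : ℕ → ℂ) :
    IsSol c φ φ' (fun j w => (act c ω a ⟨fun i => s i w⟩).val j) W := by
  refine ⟨fun w hw => (h.zero w hw).add_const ω, fun w hw => ?_, fun j w hw => ?_⟩
  · simp only [PolylogMonodromy.act, Finset.range_one, Finset.sum_singleton, Nat.sub_self,
      pow_zero, Nat.zero_add]
    refine (((h.one w hw).const_mul _).add_const _).congr_deriv ?_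
    rw [mul_add, Complex.exp_add]
    ring
  · simp only [PolylogMonodromy.act]
    simp only [Finset.sum_range_succ _ (j + 1), Nat.sub_self, pow_zero]
    have hsum : HasDerivAt (fun w => ∑ r ∈ Finset.range (j + 1),
        a r * (s 0 w ^ (j + 1 - r) / ((j + 1 - r).factorial : ℂ)))
        (∑ r ∈ Finset.range (j + 1),
          a r * (s 0 w ^ (j - r) / ((j - r).factorial : ℂ) * (φ' w / φ w))) w := by
      refine HasDerivAt.fun_sum fun r hr => HasDerivAt.const_mul _ ?_
      have : j + 1 - r = j - r + 1 := by have := Finset.mem_range.mp hr; omega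
      rw [this]
      exact hasDerivAt_pow_div_factorial (h.zero w hw) _
    refine (((h.succ j w hw).const_mul _).add (hsum.add_const _)).congr_deriv ?_
    rw [add_mul, add_div, Finset.sum_mul, Finset.sum_div]
    congr 1
    · ring
    · exact Finset.sum_congr rfl fun r _ => by ring

theorem transport_act (c ω : ℂ) (a : ℕ → ℂ) {x y : PuncturedPlane}
    (γ : Path.Homotopic.Quotient x y) (v : State) :
    transport c γ (act c ω a v) = act c ω a (transport c γ v) := by
  obtain ⟨γ⟩ := γ
  obtain ⟨τ, hτ, h0, h1⟩ := (polylogSystem c).exists_isFlat γ v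
  have key := (polylogSystem c).transport_of_isFlat γ (fun t => act c ω a (τ t)) (by
    intro t₀
    have hm : ∀ᶠ t in 𝓝 t₀, (γ t : ℂ) ∈ disc (γ t₀) :=
      γ.continuous.continuousAt.eventually
        (((polylogSystem c).isOpen_U _).mem_nhds ((polylogSystem c).mem_U _))
    filter_upwards [hτ t₀, hm] with t ht hmt
    rw [ht]
    refine State.ext (funext fun j => ?_)
    have hs := (isSol_localSol c (γ t₀) (γ t₀) (τ t₀).val).act ω a
    refine (localSol_eq hs (isOpen_disc _) (convex_disc _) (mem_disc_self _) hmt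
      (mem_disc_self _) hmt (fun i => ?_) j).symm
    simp only [localSol_self])
  simp only [h0, h1] at key
  exact key

/-- The solution `a` of the triangular system `∑ a r x ^ (j - r) / (j - r)! = d j`. -/
def solveCoeff (d : ℕ → ℂ) (x : ℂ) : ℕ → ℂ
  | j => d j - ∑ r : Fin j, solveCoeff d x r * (x ^ (j - (r : ℕ)) / ((j - (r : ℕ)).factorial : ℂ))
  decreasing_by exact r.2

/-- The logarithms force `ω`; the remaining equations for `a` are triangular with unit diagonal. -/
theorem exists_act_eq (c : ℂ) (v v' : State) :
    ∃ a, act c (v'.val 0 - v.val 0) a v = v' := by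
  set ω := v'.val 0 - v.val 0 with hω
  set d : ℕ → ℂ := fun j => v'.val (j + 1) - Complex.exp ((c - 1) * ω) * v.val (j + 1) with hd
  refine ⟨solveCoeff d (v.val 0), State.ext (funext fun j => ?_)⟩
  cases j with
  | zero => simp [act, hω]
  | succ j =>
    simp only [act]
    rw [Finset.sum_range_succ]
    conv_lhs => enter [2, 2, 1]; unfold solveCoeff
    rw [Finset.sum_range]
    simp [hd]

/-! ### The power series solution in the coordinate `log z` -/

/-- The modulus of `n + c` tends to infinity. A resonant index `n = -c` does no harm, since its
inverse is `0` by convention. -/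
theorem exists_norm_coeff_le (c : ℂ) (j : ℕ) :
    ∃ K : ℝ, 0 ≤ K ∧ ∀ n : ℕ, ‖(((n : ℂ) + c) ^ j)⁻¹‖ ≤ K := by
  have h1 : Tendsto (fun n : ℕ => ‖(n : ℂ) + c‖) atTop atTop := by
    refine tendsto_atTop_mono (f := fun n : ℕ => (n : ℝ) - ‖c‖) (fun n => ?_)
      (tendsto_atTop_add_const_right _ _ tendsto_natCast_atTop_atTop)
    have := norm_sub_le ((n : ℂ) + c) c
    simp only [add_sub_cancel_right, Complex.norm_natCast] at this
    linarith
  obtain ⟨K, hK⟩ := (h1.inv_tendsto_atTop).bddAbove_range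
  have hK' : ∀ n : ℕ, ‖(n : ℂ) + c‖⁻¹ ≤ K := fun n => hK ⟨n, rfl⟩
  have hK0 : 0 ≤ K := (inv_nonneg.mpr (norm_nonneg _)).trans (hK' 0)
  refine ⟨K ^ j, pow_nonneg hK0 _, fun n => ?_⟩
  rw [norm_inv, norm_pow, ← inv_pow]
  exact pow_le_pow_left₀ (inv_nonneg.mpr (norm_nonneg _)) (hK' n) _

theorem norm_exp_natCast_mul (n : ℕ) (w : ℂ) :
    ‖Complex.exp (n * w)‖ = Real.exp w.re ^ n := by
  rw [Complex.norm_exp, ← Real.exp_nat_mul]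
  simp

/-- The series `∑ exp (n w) / (n + c) ^ j`. -/
def expSeries (c : ℂ) (j : ℕ) (w : ℂ) : ℂ := ∑' n : ℕ, Complex.exp (n * w) / ((n : ℂ) + c) ^ j

theorem summable_expSeries (c : ℂ) (j : ℕ) {w : ℂ} (hw : w.re < 0) :
    Summable fun n : ℕ => Complex.exp (n * w) / ((n : ℂ) + c) ^ j := by
  obtain ⟨K, -, hK⟩ := exists_norm_coeff_le c j
  refine Summable.of_norm_bounded
    ((summable_geometric_of_lt_one (Real.exp_pos w.re).le (by simpa using hw)).mul_right K)
    fun n => ?_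
  rw [div_eq_mul_inv, norm_mul, norm_exp_natCast_mul]
  gcongr
  exact hK n

theorem hasDerivAt_expSeries (c : ℂ) (j : ℕ) {w : ℂ} (hw : w.re < 0) :
    (Summable fun n : ℕ => n * (Complex.exp (n * w) / ((n : ℂ) + c) ^ j)) ∧
    HasDerivAt (expSeries c j)
      (∑' n : ℕ, n * (Complex.exp (n * w) / ((n : ℂ) + c) ^ j)) w := by
  obtain ⟨K, hK0, hK⟩ := exists_norm_coeff_le c j
  set r : ℝ := Real.exp (w.re / 2) with hr
  have hr1 : ‖r‖ < 1 := by
    rw [hr, Real.norm_eq_abs, abs_of_pos (Real.exp_pos _), Real.exp_lt_one_iff]; linarith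
  have hsum : Summable fun n : ℕ => (n : ℝ) * r ^ n * K := by
    have := summable_pow_mul_geometric_of_norm_lt_one 1 hr1
    simpa using this.mul_right K
  have hopen : IsOpen {u : ℂ | u.re < w.re / 2} := isOpen_lt Complex.continuous_re continuous_const
  have hconv : Convex ℝ {u : ℂ | u.re < w.re / 2} := convex_halfSpace_re_lt _
  have hb : ∀ n : ℕ, ∀ u ∈ {u : ℂ | u.re < w.re / 2},
      ‖n * (Complex.exp (n * u) / ((n : ℂ) + c) ^ j)‖ ≤ n * r ^ n * K := by
    intro n u hu
    rw [div_eq_mul_inv, norm_mul, norm_mul, norm_exp_natCast_mul, Complex.norm_natCast, mul_assoc]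
    gcongr
    · exact Real.exp_le_exp.mpr (le_of_lt hu)
    · exact hK n
  have hmem : w ∈ {u : ℂ | u.re < w.re / 2} := by
    change w.re < w.re / 2; linarith
  refine ⟨Summable.of_norm_bounded hsum fun n => hb n w hmem, ?_⟩
  refine hasDerivAt_tsum_of_isPreconnected hsum hopen hconv.isPreconnected
    (fun n u _ => ?_) hb hmem (summable_expSeries c j hw) hmem
  have h1 : HasDerivAt (fun u : ℂ => (n : ℂ) * u) n u := by
    simpa using (hasDerivAt_id u).const_mul (n : ℂ)
  exact (h1.cexp.div_const _).congr_deriv (by ring)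

/-- `1` if `c` is one of `0, -1, -2, …`, and `0` otherwise. -/
def eps (c : ℂ) : ℂ := open Classical in if ∃ k : ℕ, (k : ℂ) + c = 0 then 1 else 0

/-- Differentiating `exp ((n + c) w)` cancels one factor `n + c`. A resonant term is absent on the
left, because division by `0 ^ (j + 1)` gives `0`; the right side must omit it explicitly, which
matters for `j = 0`. -/
theorem hasDerivAt_exp_mul_expSeries (c : ℂ) (j : ℕ) {w : ℂ} (hw : w.re < 0) :
    HasDerivAt (fun u => Complex.exp (c * u) * expSeries c (j + 1) u)
      (Complex.exp (c * w) * ∑' n : ℕ,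
        (if (n : ℂ) + c = 0 then 0 else Complex.exp (n * w) / ((n : ℂ) + c) ^ j)) w := by
  have h1 : HasDerivAt (fun u : ℂ => c * u) c w := by
    simpa using (hasDerivAt_id w).const_mul c
  obtain ⟨hs, hd⟩ := hasDerivAt_expSeries c (j + 1) hw
  refine (h1.cexp.mul hd).congr_deriv ?_
  rw [mul_assoc, ← mul_add, expSeries, ← tsum_mul_left,
    ← ((summable_expSeries c (j + 1) hw).mul_left c).tsum_add hs]
  congr 1
  refine tsum_congr fun n => ?_
  split_ifs with h
  · rw [h]; simp
  · field_simp
    ring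

/-- This is the geometric series. If `c = -k`, the omitted term is `exp (c w) * exp (k w) = 1`,
which `eps c` restores; its iterated primitives are the powers of `w` in `seriesSol`. -/
theorem tsum_exp_sub (c : ℂ) {w : ℂ} (hw : w.re < 0) :
    Complex.exp (c * w) * (∑' n : ℕ, if (n : ℂ) + c = 0 then 0 else Complex.exp (n * w)) +
      eps c = Complex.exp (c * w) / (1 - Complex.exp w) := by
  have hn : ‖Complex.exp w‖ < 1 := by rw [Complex.norm_exp]; simpa using hw
  have hg : HasSum (fun n : ℕ => Complex.exp (n * w)) (1 - Complex.exp w)⁻¹ := by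
    simpa only [Complex.exp_nat_mul] using hasSum_geometric_of_norm_lt_one hn
  rw [div_eq_mul_inv, ← hg.tsum_eq]
  by_cases h : ∃ k : ℕ, (k : ℂ) + c = 0
  · rw [eps, if_pos h]
    obtain ⟨k, hk⟩ := h
    have hc : c = -k := by linear_combination hk
    rw [hg.summable.tsum_eq_add_tsum_ite k, mul_add, ← Complex.exp_add, add_comm, hc]
    congr 1
    · rw [show -(k : ℂ) * w + k * w = 0 by ring, Complex.exp_zero]
    · congr 1
      refine tsum_congr fun n => if_congr ?_ rfl rfl
      rw [add_neg_eq_zero, Nat.cast_inj]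
  · rw [eps, if_neg h, add_zero]
    push Not at h
    simp [h]

/-- The solution of the differential system in the half plane `Re w < 0`, where `z = exp w`,
given by the power series of the polylogarithms. -/
def seriesSol (c : ℂ) : ℕ → ℂ → ℂ
  | 0, w => w
  | j + 1, w => Complex.exp (c * w) * expSeries c (j + 1) w +
      eps c * (w ^ (j + 1) / ((j + 1).factorial : ℂ))

theorem isSol_seriesSol (c : ℂ) :
    IsSol c Complex.exp Complex.exp (seriesSol c) {w | w.re < 0} := by
  refine ⟨fun w hw => ?_, fun w hw => ?_, fun j w hw => ?_⟩
  · rw [div_self (Complex.exp_ne_zero w)]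
    exact hasDerivAt_id w
  · refine ((hasDerivAt_exp_mul_expSeries c 0 hw).add
      ((hasDerivAt_pow_div_factorial (hasDerivAt_id w) 0).const_mul (eps c))).congr_deriv ?_
    have := tsum_exp_sub c hw
    simp only [pow_zero, div_one, Nat.factorial_zero, Nat.cast_one, mul_one]
    rw [this, seriesSol, ← Complex.exp_add]
    congr 2
    ring
  · refine ((hasDerivAt_exp_mul_expSeries c (j + 1) hw).add
      ((hasDerivAt_pow_div_factorial (hasDerivAt_id w) (j + 1)).const_mul (eps c))).congr_deriv ?_
    rw [mul_div_assoc, div_self (Complex.exp_ne_zero w), mul_one, mul_one, seriesSol, expSeries]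
    congr 2
    refine tsum_congr fun n => ?_
    split_ifs with h
    · rw [h]; simp
    · rfl

/-! ### Paths with logarithm in the left half plane, and the base state -/

/-- The part of the closed left half plane on which `exp` takes values in `ℂ ∖ {0, 1}`. -/
def leftHalf : Set ℂ := {w | w.re ≤ 0 ∧ Complex.exp w ≠ 1}

theorem exp_ne_one_of_re_neg {w : ℂ} (h : w.re < 0) : Complex.exp w ≠ 1 := by
  intro h1
  have := congrArg norm h1
  rw [Complex.norm_exp, norm_one, Real.exp_eq_one_iff] at this
  exact h.ne this

/-- A segment from a point of the closed half plane towards `-1` enters the open half plane at once,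
and the removed points all lie on the boundary. -/
theorem starConvex_leftHalf : StarConvex ℝ (-1 : ℂ) leftHalf := by
  rintro w ⟨hw, hw1⟩ a b ha hb hab
  rcases ha.eq_or_lt with rfl | ha
  · obtain rfl : b = 1 := by linarith
    simpa using ⟨hw, hw1⟩
  · have h : (a • (-1 : ℂ) + b • w).re < 0 := by
      simp
      nlinarith
    exact ⟨h.le, exp_ne_one_of_re_neg h⟩

instance : ContractibleSpace leftHalf :=
  starConvex_leftHalf.contractibleSpace ⟨-1, by simp, exp_ne_one_of_re_neg (by simp)⟩

/-- The exponential map to `ℂ ∖ {0, 1}`. -/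
def expMap (w : leftHalf) : PuncturedPlane :=
  ⟨Complex.exp w, Complex.exp_ne_zero _, w.2.2⟩

theorem continuous_expMap : Continuous expMap :=
  (Complex.continuous_exp.comp continuous_subtype_val).subtype_mk _

/-- The path `w` in the closed left half plane is a logarithm of the path `γ`. -/
def IsLift {x y : PuncturedPlane} {a b : ℂ} (γ : Path x y) (w : Path a b) : Prop :=
  ∀ t, (w t).re ≤ 0 ∧ Complex.exp (w t) = γ t

theorem IsLift.trans {x y z : PuncturedPlane} {a b d : ℂ} {γ : Path x y} {γ' : Path y z}
    {w : Path a b} {w' : Path b d} (h : IsLift γ w) (h' : IsLift γ' w') :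
    IsLift (γ.trans γ') (w.trans w') := by
  intro t
  simp only [Path.trans_apply]
  split_ifs
  · exact h _
  · exact h' _

theorem exists_isLift {x y : PuncturedPlane} {a b : ℂ} (w : Path a b) (ha : Complex.exp a = x)
    (hb : Complex.exp b = y) (h : ∀ t, w t ∈ leftHalf) : ∃ γ : Path x y, IsLift γ w := by
  refine ⟨⟨⟨fun t => expMap ⟨w t, h t⟩, continuous_expMap.comp (w.continuous.subtype_mk _)⟩,
    Subtype.ext ?_, Subtype.ext ?_⟩, fun t => ⟨(h t).1, rfl⟩⟩
  · simpa [expMap] using ha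
  · simpa [expMap] using hb

/-- The two logarithms are paths with the same ends in the contractible space `leftHalf`; `exp`
carries a homotopy between them to `ℂ ∖ {0, 1}`. -/
theorem mk_eq_of_isLift {x y : PuncturedPlane} {a b : ℂ} {γ γ' : Path x y} {w w' : Path a b}
    (h : IsLift γ w) (h' : IsLift γ' w') :
    Path.Homotopic.Quotient.mk γ = Path.Homotopic.Quotient.mk γ' := by
  have mem : ∀ {γ : Path x y} {w : Path a b}, IsLift γ w → ∀ t, w t ∈ leftHalf :=
    fun {γ w} h t => ⟨(h t).1, by rw [(h t).2]; exact (γ t).2.2⟩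
  have ha : a ∈ leftHalf := by simpa using mem h 0
  have hb : b ∈ leftHalf := by simpa using mem h 1
  have hx : x = expMap ⟨a, ha⟩ := Subtype.ext (by simpa [expMap] using (h 0).2.symm)
  have hy : y = expMap ⟨b, hb⟩ := Subtype.ext (by simpa [expMap] using (h 1).2.symm)
  subst hx hy
  let toPath : ∀ {γ : Path (expMap ⟨a, ha⟩) (expMap ⟨b, hb⟩)} {w : Path a b}, IsLift γ w →
      Path (⟨a, ha⟩ : leftHalf) ⟨b, hb⟩ := fun {γ w} h =>
    ⟨⟨fun t => ⟨w t, mem h t⟩, w.continuous.subtype_mk _⟩, Subtype.ext w.source,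
      Subtype.ext w.target⟩
  have hmap : ∀ {γ : Path (expMap ⟨a, ha⟩) (expMap ⟨b, hb⟩)} {w : Path a b} (h : IsLift γ w),
      (toPath h).map continuous_expMap = γ := fun {γ w} h =>
    Path.ext (funext fun t => Subtype.ext (h t).2)
  have key := (SimplyConnectedSpace.paths_homotopic (toPath h) (toPath h')).map
    ⟨expMap, continuous_expMap⟩
  rw [Path.Homotopic.Quotient.eq]
  have e1 := hmap h
  have e2 := hmap h'
  rw [← e1, ← e2]
  exact key

theorem transport_surjective (c : ℂ) {x y : PuncturedPlane} (γ : Path.Homotopic.Quotient x y) :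
    Function.Surjective (transport c γ) := by
  intro v
  refine ⟨transport c γ.symm v, ?_⟩
  rw [← transport_trans, Path.Homotopic.Quotient.symm_trans]
  exact (polylogSystem c).transport_refl _ v

/-- The states of the power series solution. -/
def seriesState (c w : ℂ) : State := ⟨fun j => seriesSol c j w⟩

theorem transport_seriesState (c : ℂ) {x y : PuncturedPlane} {a b : ℂ} {γ : Path x y}
    {w : Path a b} (h : IsLift γ w) (hw : ∀ t, (w t).re < 0) :
    transport c (Path.Homotopic.Quotient.mk γ) (seriesState c a) = seriesState c b := by
  have := transport_of_sol (isOpen_lt Complex.continuous_re continuous_const) (isSol_seriesSol c)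
    (fun u _ => Complex.hasDerivAt_exp u) γ w w.continuous hw fun t => (h t).2
  simpa [transport, seriesState] using this

theorem exp_log_base : Complex.exp (Real.pi * Complex.I) = (base : ℂ) := Complex.exp_pi_mul_I

theorem exists_isLift_segment {b : ℂ} (hb : b.re < 0) :
    ∃ γ : Path base ⟨Complex.exp b, Complex.exp_ne_zero _, exp_ne_one_of_re_neg hb⟩,
      ∃ w : Path (Real.pi * Complex.I) b, IsLift γ w := by
  obtain ⟨γ, h⟩ := exists_isLift (x := base) (y := ⟨Complex.exp b, Complex.exp_ne_zero _,
    exp_ne_one_of_re_neg hb⟩) (Path.segment (Real.pi * Complex.I) b) exp_log_base rfl (by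
      intro t
      rw [Path.segment_apply, AffineMap.lineMap_apply]
      rcases t.2.1.eq_or_lt with ht | ht
      · rw [← ht]
        simp only [zero_smul, zero_vadd]
        refine ⟨by simp, ?_⟩
        rw [Complex.exp_pi_mul_I]; norm_num
      · have : (((t : ℝ) • (b -ᵥ (Real.pi * Complex.I)) +ᵥ (Real.pi * Complex.I) : ℂ)).re < 0 := by
          simpa using mul_neg_of_pos_of_neg ht hb
        exact ⟨this.le, exp_ne_one_of_re_neg this⟩)
  exact ⟨γ, _, h⟩

/-- The logarithm `π i` of the base point lies on the boundary of the half plane of convergence, so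
the series is not evaluated there. Its state at `w = -1` is pulled back along one path instead, and
`mk_eq_of_isLift` makes the result independent of the path. -/
theorem exists_baseState (c : ℂ) : ∃ v : State, ∀ (z : PuncturedPlane) (b : ℂ) (γ : Path base z)
    (w : Path (Real.pi * Complex.I) b), IsLift γ w → b.re < 0 →
      transport c (Path.Homotopic.Quotient.mk γ) v = seriesState c b := by
  have hpre : (-1 : ℂ).re < 0 := by simp
  obtain ⟨γ₀, w₀, h₀⟩ := exists_isLift_segment hpre
  obtain ⟨v, hv⟩ := transport_surjective c (Path.Homotopic.Quotient.mk γ₀) (seriesState c (-1))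
  refine ⟨v, fun z b γ w h hb => ?_⟩
  have hseg : ∀ t, (Path.segment (-1) b t).re < 0 := by
    intro t
    have h1 := (convex_halfSpace_re_lt (0 : ℝ)).segment_subset hpre hb
    exact h1 (by rw [← Path.range_segment]; exact ⟨t, rfl⟩)
  obtain ⟨γ₁, h₁⟩ := exists_isLift (x := ⟨Complex.exp (-1), Complex.exp_ne_zero _,
    exp_ne_one_of_re_neg hpre⟩) (y := z) (Path.segment (-1) b) rfl (by simpa using (h 1).2)
    fun t => ⟨(hseg t).le, exp_ne_one_of_re_neg (hseg t)⟩
  rw [mk_eq_of_isLift h (h₀.trans h₁), Path.Homotopic.Quotient.mk_trans, transport_trans, hv]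
  exact transport_seriesState c h₁ hseg

/-- The state at the base point of the solution which is given by the power series. -/
def baseState (c : ℂ) : State := (exists_baseState c).choose

theorem transport_baseState (c : ℂ) {z : PuncturedPlane} {b : ℂ} {γ : Path base z}
    {w : Path (Real.pi * Complex.I) b} (h : IsLift γ w) (hb : b.re < 0) :
    transport c (Path.Homotopic.Quotient.mk γ) (baseState c) = seriesState c b :=
  (exists_baseState c).choose_spec z b γ w h hb

theorem baseState_val_zero (c : ℂ) : (baseState c).val 0 = Real.pi * Complex.I := by
  obtain ⟨γ, w, h⟩ := exists_isLift_segment (b := -1) (by simp)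
  have h1 := transport_baseState c h (by simp)
  have h2 := transport_val_zero c γ (baseState c) w w.continuous fun t => (h t).2
  rw [h1, Path.source, Path.target] at h2
  simp only [seriesState, seriesSol] at h2
  linear_combination -h2

theorem exists_isLift_log {z : PuncturedPlane} (γ : Path base z)
    (h : ∀ t, 0 < t → ‖((γ t : PuncturedPlane) : ℂ)‖ < 1 ∧ 0 < ((γ t : PuncturedPlane) : ℂ).im) :
    ∃ w : Path (Real.pi * Complex.I) (Complex.log z), IsLift γ w := by
  have hcont : Continuous fun t => Complex.log (γ t) := by
    rw [continuous_iff_continuousAt]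
    intro t
    have hγ : ContinuousAt (fun t => (γ t : ℂ)) t :=
      continuous_subtype_val.continuousAt.comp γ.continuous.continuousAt
    rcases eq_or_lt_of_le (unitInterval.nonneg' (t := t)) with rfl | ht
    · have h0 : (γ 0 : ℂ) = -1 := by rw [γ.source]; rfl
      -- The principal logarithm jumps at `-1`, but it is continuous from the closed upper half
      -- plane, where the path stays.
      have h1 : ContinuousWithinAt Complex.log {z : ℂ | 0 ≤ z.im} (γ 0 : ℂ) := by
        rw [h0]
        exact Complex.continuousWithinAt_log_of_re_neg_of_im_zero (by simp) (by simp)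
      refine h1.tendsto.comp (tendsto_nhdsWithin_iff.mpr ⟨hγ, Eventually.of_forall fun s => ?_⟩)
      rcases eq_or_lt_of_le (unitInterval.nonneg' (t := s)) with rfl | hs
      · change 0 ≤ (γ 0 : ℂ).im
        rw [h0]; simp
      · exact (h s hs).2.le
    · exact hγ.clog (Or.inr (h t ht).2.ne')
  refine ⟨⟨⟨_, hcont⟩, ?_, ?_⟩, fun t => ⟨?_, Complex.exp_log (γ t).2.1⟩⟩
  · change Complex.log (γ 0) = _
    rw [γ.source]
    exact Complex.log_neg_one
  · change Complex.log (γ 1) = _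
    rw [γ.target]
  · change (Complex.log (γ t)).re ≤ 0
    rw [Complex.log_re]
    refine Real.log_nonpos (norm_nonneg _) ?_
    rcases eq_or_lt_of_le (unitInterval.nonneg' (t := t)) with rfl | ht
    · rw [γ.source]; simp [base]
    · exact (h t ht).1.le

/-! ### Monodromy around `0` -/

theorem add_pow_div_factorial (x y : ℂ) (n : ℕ) :
    (x + y) ^ n / (n.factorial : ℂ) = ∑ r ∈ Finset.range (n + 1),
      x ^ r / (r.factorial : ℂ) * (y ^ (n - r) / ((n - r).factorial : ℂ)) := by
  rw [add_pow, Finset.sum_div]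
  refine Finset.sum_congr rfl fun r hr => ?_
  rw [Nat.cast_choose ℂ (Finset.mem_range_succ_iff.mp hr)]
  have h1 : (n.factorial : ℂ) ≠ 0 := by exact_mod_cast n.factorial_ne_zero
  have h2 : (r.factorial : ℂ) ≠ 0 := by exact_mod_cast r.factorial_ne_zero
  have h3 : ((n - r).factorial : ℂ) ≠ 0 := by exact_mod_cast (n - r).factorial_ne_zero
  field_simp

theorem exp_int_mul_add (n : ℕ) (w : ℂ) :
    Complex.exp (n * (w + 2 * Real.pi * Complex.I)) = Complex.exp (n * w) := by
  rw [mul_add, Complex.exp_add, Complex.exp_nat_mul_two_pi_mul_I, mul_one]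

theorem eps_mul_exp (c : ℂ) :
    eps c * Complex.exp ((c - 1) * (2 * Real.pi * Complex.I)) = eps c := by
  unfold eps
  split_ifs with h
  · obtain ⟨k, hk⟩ := h
    rw [one_mul, show (c - 1) * (2 * Real.pi * Complex.I) =
      -(((k + 1 : ℕ) : ℂ) * (2 * Real.pi * Complex.I)) by
        push_cast; linear_combination (2 * Real.pi * Complex.I) * hk, Complex.exp_neg, Complex.exp_nat_mul_two_pi_mul_I, inv_one]
  · rw [zero_mul]

/-- The series in `exp w` is periodic, so only the prefactor `exp (c w)` and the powers of `w`
change. The latter expand by the binomial theorem; their leading term fits the symmetry because `exp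
((c - 1) 2 π i) = 1` whenever `eps c ≠ 0`. -/
theorem seriesState_add (c w : ℂ) :
    seriesState c (w + 2 * Real.pi * Complex.I) = act c (2 * Real.pi * Complex.I)
      (fun r => eps c * ((2 * Real.pi * Complex.I) ^ (r + 1) / ((r + 1).factorial : ℂ)))
      (seriesState c w) := by
  refine State.ext (funext fun j => ?_)
  cases j with
  | zero => rfl
  | succ j =>
    simp only [seriesState, seriesSol, act, expSeries, exp_int_mul_add]
    set ω : ℂ := 2 * Real.pi * Complex.I with hω
    have h1 : Complex.exp (c * (w + ω)) = Complex.exp ((c - 1) * ω) * Complex.exp (c * w) := by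
      rw [← Complex.exp_add, show c * (w + ω) = (c - 1) * ω + c * w + ω by ring,
        Complex.exp_add _ ω, hω, Complex.exp_two_pi_mul_I, mul_one]
    rw [h1, add_comm w ω, add_pow_div_factorial, Finset.sum_range_succ', mul_add, mul_add,
      Finset.mul_sum]
    have h2 := eps_mul_exp c
    rw [← hω] at h2
    simp only [pow_zero, Nat.factorial_zero, Nat.cast_one, div_one, one_mul, Nat.sub_zero,
      Nat.add_sub_add_right]
    simp only [← mul_assoc, h2, mul_comm (Complex.exp ((c - 1) * ω)) (eps c)]
    ring

/-- The logarithm of the loop `Z₀`. -/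
def logCircle (t : unitInterval) : ℂ :=
  Real.log (3 / 4) + Real.pi * Complex.I + 2 * Real.pi * Complex.I * (t : ℝ) +
    Complex.log (1 + 1 / 3 * Complex.exp (-(2 * Real.pi * Complex.I * (t : ℝ))))

theorem norm_exp_neg_angle (t : ℝ) : ‖Complex.exp (-(2 * Real.pi * Complex.I * t))‖ = 1 := by
  rw [Complex.exp_neg, norm_inv, norm_exp_angle, inv_one]

theorem one_add_mem_slitPlane {r : ℝ} (h0 : 0 ≤ r) (h1 : r < 1) {e : ℂ} (he : ‖e‖ = 1) :
    1 + r * e ∈ Complex.slitPlane := by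
  refine Complex.mem_slitPlane_of_norm_lt_one ?_
  rw [norm_mul, he, mul_one, Complex.norm_real, Real.norm_eq_abs, abs_of_nonneg h0]
  exact h1

theorem continuous_logCircle : Continuous logCircle := by
  unfold logCircle
  refine Continuous.add (by fun_prop) (Continuous.clog (by fun_prop) fun t => ?_)
  have := one_add_mem_slitPlane (r := 1 / 3) (by norm_num) (by norm_num) (norm_exp_neg_angle t)
  push_cast at this
  exact this

/-- With `e = exp (2 π i t)`, the circle is `(3 / 4) * (-1) * e * (1 + e⁻¹ / 3)`. The last factor
stays within `1 / 3` of `1`, so its principal logarithm is continuous. -/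
theorem exp_logCircle (t : unitInterval) : Complex.exp (logCircle t) = circleFun t := by
  have h := one_add_mem_slitPlane (r := 1 / 3) (by norm_num) (by norm_num) (norm_exp_neg_angle t)
  push_cast at h
  unfold logCircle circleFun
  rw [Complex.exp_add, Complex.exp_add, Complex.exp_add, Complex.exp_log
    (Complex.slitPlane_ne_zero h), ← Complex.ofReal_exp, Real.exp_log (by norm_num),
    Complex.exp_pi_mul_I, Complex.exp_neg]
  have := Complex.exp_ne_zero (2 * Real.pi * Complex.I * (t : ℝ))
  push_cast
  field_simp
  ring

theorem exists_isLift_pathZ0 :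
    ∃ w : Path (Real.pi * Complex.I) (Real.pi * Complex.I + 2 * Real.pi * Complex.I),
      IsLift pathZ0 w := by
  have hl : (Real.log (3 / 4) : ℂ) + Complex.log (1 + 1 / 3) = 0 := by
    rw [show (1 + 1 / 3 : ℂ) = ((4 / 3 : ℝ) : ℂ) by push_cast; norm_num,
      ← Complex.ofReal_log (by norm_num), ← Complex.ofReal_add,
      ← Real.log_mul (by norm_num) (by norm_num)]
    norm_num
  refine ⟨⟨⟨logCircle, continuous_logCircle⟩, ?_, ?_⟩, fun t => ⟨?_, exp_logCircle t⟩⟩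
  · change logCircle 0 = _
    simp only [logCircle, Set.Icc.coe_zero, Complex.ofReal_zero, mul_zero, neg_zero,
      Complex.exp_zero, mul_one, add_zero]
    linear_combination hl
  · change logCircle 1 = _
    simp only [logCircle, Set.Icc.coe_one, Complex.ofReal_one, mul_one, Complex.exp_neg,
      Complex.exp_two_pi_mul_I, inv_one]
    linear_combination hl
  · change (logCircle t).re ≤ 0
    rw [← Real.exp_le_one_iff, ← Complex.norm_exp, exp_logCircle, circleFun]
    refine (norm_sub_le _ _).trans ?_
    rw [norm_mul, norm_exp_angle]
    norm_num

theorem IsLift.add_two_pi {x y : PuncturedPlane} {a b : ℂ} {γ : Path x y} {w : Path a b}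
    (h : IsLift γ w) :
    IsLift γ (w.map (f := fun z => z + 2 * Real.pi * Complex.I) (by fun_prop)) := by
  intro t
  obtain ⟨h1, h2⟩ := h t
  simp only [Path.map_coe, Function.comp_apply]
  refine ⟨by simpa using h1, ?_⟩
  rw [Complex.exp_add, Complex.exp_two_pi_mul_I, mul_one, h2]

theorem transport_pathZ0 (c : ℂ) :
    transport c (Path.Homotopic.Quotient.mk pathZ0) (baseState c) =
      act c (2 * Real.pi * Complex.I)
        (fun r => eps c * ((2 * Real.pi * Complex.I) ^ (r + 1) / ((r + 1).factorial : ℂ)))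
        (baseState c) := by
  have hb : (-1 : ℂ).re < 0 := by simp
  obtain ⟨γ, w, h⟩ := exists_isLift_segment hb
  obtain ⟨w', h'⟩ := exists_isLift_pathZ0
  -- Transporting on to `w = -1` compares both sides inside the region of convergence: the lift of
  -- `Z₀` followed by the shifted lift of `γ` ends at `-1 + 2 π i`.
  refine transport_injective c (Path.Homotopic.Quotient.mk γ) ?_
  rw [transport_act, transport_baseState c h hb, ← seriesState_add, ← transport_trans,
    ← Path.Homotopic.Quotient.mk_trans]
  exact transport_baseState c (h'.trans h.add_two_pi) (by simp)

/-! ### Monodromy around `1` -/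

theorem exp_ne_one_of_norm_lt {u : ℂ} (hu : u ≠ 0) (h : ‖u‖ < 2 * Real.pi) :
    Complex.exp u ≠ 1 := by
  intro h1
  obtain ⟨n, rfl⟩ := Complex.exp_eq_one_iff.mp h1
  have hn : n ≠ 0 := by rintro rfl; simp at hu
  have h2 : (1 : ℝ) ≤ |(n : ℝ)| := by exact_mod_cast Int.one_le_abs hn
  simp only [norm_mul, Complex.norm_I, mul_one, Complex.norm_real, Complex.norm_intCast,
    Complex.norm_ofNat, Real.norm_eq_abs, abs_of_pos Real.pi_pos] at h
  nlinarith [Real.pi_pos]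

theorem exists_regular_part (c : ℂ) : ∃ K : ℂ → ℂ,
    DifferentiableOn ℂ K (Metric.ball 0 (2 * Real.pi)) ∧
    ∀ u, u ≠ 0 → ‖u‖ < 2 * Real.pi →
      Complex.exp (c * u) / (1 - Complex.exp u) = -1 / u + K u := by
  have hpi := Real.two_pi_pos
  have hnhds : Metric.ball (0 : ℂ) (2 * Real.pi) ∈ 𝓝 0 := Metric.ball_mem_nhds _ hpi
  set q : ℂ → ℂ := dslope Complex.exp 0 with hq
  have hq0 : q 0 = 1 := by simp [hq]
  have hqu : ∀ u, u ≠ 0 → q u = (Complex.exp u - 1) / u := by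
    intro u hu
    rw [hq, dslope_of_ne _ hu, slope_def_field]
    simp
  have hqd : DifferentiableOn ℂ q (Metric.ball 0 (2 * Real.pi)) :=
    (Complex.differentiableOn_dslope hnhds).mpr Complex.differentiable_exp.differentiableOn
  have hqne : ∀ u ∈ Metric.ball (0 : ℂ) (2 * Real.pi), q u ≠ 0 := by
    intro u hu
    by_cases h : u = 0
    · rw [h, hq0]; exact one_ne_zero
    · rw [hqu u h]
      exact div_ne_zero (sub_ne_zero.mpr (exp_ne_one_of_norm_lt h (by simpa using hu))) h
  set N : ℂ → ℂ := fun u => q u - Complex.exp (c * u) with hN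
  have hN0 : N 0 = 0 := by simp [hN, hq0]
  have hNd : DifferentiableOn ℂ N (Metric.ball 0 (2 * Real.pi)) :=
    hqd.sub (by fun_prop)
  -- With `q = (exp u - 1) / u` the left side is `-exp (c u) / (u q)`. Adding `1 / u` gives `(q -
  -- exp (c u)) / (u q) = (N / u) / q`, where `N 0 = 0` removes the pole.
  refine ⟨fun u => dslope N 0 u / q u,
    ((Complex.differentiableOn_dslope hnhds).mpr hNd).div hqd hqne, fun u hu hu' => ?_⟩
  have h1 := exp_ne_one_of_norm_lt hu hu'
  beta_reduce
  rw [dslope_of_ne _ hu, slope_def_field, hN0]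
  simp only [hN, hqu u hu, sub_zero]
  have h2 : Complex.exp u - 1 ≠ 0 := sub_ne_zero.mpr h1
  have h3 : 1 - Complex.exp u ≠ 0 := sub_ne_zero.mpr h1.symm
  field_simp
  ring

/-- A solution near `z = 1` in the coordinate `v = log (log z)`, given in terms of the holomorphic
functions `h` of `u = log z`. -/
def logSol (h : ℕ → ℂ → ℂ) : ℕ → ℂ → ℂ
  | 0, v => Complex.exp v
  | j + 1, v => h j (Complex.exp v) - Complex.exp v ^ j / (j.factorial : ℂ) * v

theorem exists_isSol_logSol (c : ℂ) (x : ℂ) (y : ℕ → ℂ) : ∃ h : ℕ → ℂ → ℂ, (∀ j, h j x = y j) ∧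
    IsSol c (fun v => Complex.exp (Complex.exp v))
      (fun v => Complex.exp (Complex.exp v) * Complex.exp v) (logSol h)
      {v | v.re < Real.log (2 * Real.pi)} := by
  obtain ⟨K, hKd, hK⟩ := exists_regular_part c
  obtain ⟨S, hS0, hS⟩ := exists_primitive_chain (a := 0) (r := 2 * Real.pi) (x := x)
    -- Differentiating `u ^ (j + 1) / (j + 1)! * v` also produces `u ^ (j + 1) / (j + 1)!` from `v`.
    -- The holomorphic parts compensate by `h (j + 1)' = h j + u ^ j / (j + 1)!`, with `h j = S (j +
    -- 1)` and `S 0 = K`.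
    (fun n f u => if n = 0 then f u else f u + u ^ (n - 1) / (n.factorial : ℂ)) (by
      intro n f hf
      by_cases hn : n = 0
      · simpa [hn] using hf
      · simp only [hn, if_false]
        exact hf.add (by fun_prop)) K hKd y
  have hmem : ∀ v : ℂ, v.re < Real.log (2 * Real.pi) → ‖Complex.exp v‖ < 2 * Real.pi := by
    intro v hv
    rw [Complex.norm_exp]
    exact (Real.lt_log_iff_exp_lt Real.two_pi_pos).mp hv
  refine ⟨fun j => S (j + 1), fun j => (hS j).1, fun v hv => ?_, fun v hv => ?_, fun j v hv => ?_⟩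
  · refine (Complex.hasDerivAt_exp v).congr_deriv ?_
    have := Complex.exp_ne_zero (Complex.exp v)
    field_simp
  · have h1 := hmem v hv
    have h2 := ((hS 0).2 (Complex.exp v) (by simpa using h1)).comp v (Complex.hasDerivAt_exp v)
    refine (h2.sub ((hasDerivAt_id v).const_mul
      (Complex.exp v ^ 0 / ((0 : ℕ).factorial : ℂ)))).congr_deriv ?_ |>.congr_of_eventuallyEq ?_
    · have h3 := hK _ (Complex.exp_ne_zero v) h1
      have h4 : Complex.exp ((c - 1) * Complex.exp v) * Complex.exp (Complex.exp v) =
          Complex.exp (c * Complex.exp v) := by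
        rw [← Complex.exp_add]; congr 1; ring
      have h5 := Complex.exp_ne_zero v
      simp only [logSol, if_true, hS0, pow_zero, Nat.factorial_zero, Nat.cast_one]
      rw [← mul_assoc, h4, mul_div_right_comm, h3]
      field_simp
      ring
    · refine Eventually.of_forall fun w => ?_
      simp [logSol]
  · have h1 := hmem v hv
    have h2 := ((hS (j + 1)).2 (Complex.exp v) (by simpa using h1)).comp v
      (Complex.hasDerivAt_exp v)
    refine (h2.sub ((hasDerivAt_pow_div_factorial (Complex.hasDerivAt_exp v) j).mul
      (hasDerivAt_id v))).congr_deriv ?_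
    have h5 := Complex.exp_ne_zero (Complex.exp v)
    have h6 : (j.factorial : ℂ) ≠ 0 := by exact_mod_cast j.factorial_ne_zero
    have h7 : ((j + 1).factorial : ℂ) ≠ 0 := by exact_mod_cast (j + 1).factorial_ne_zero
    simp only [logSol, Nat.add_sub_cancel, id, if_neg (Nat.succ_ne_zero j)]
    field_simp
    ring

/-- The iterated logarithm of the loop `Z₁`. -/
def logLogAroundOne (t : unitInterval) : ℂ :=
  Real.log (2 * Real.pi / 3) + Real.pi * Complex.I / 2 + 2 * Real.pi * Complex.I * (t : ℝ) +
    Complex.log (1 + 1 / 2 * Complex.exp (-(2 * Real.pi * Complex.I * (t : ℝ))))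

theorem continuous_logLogAroundOne : Continuous logLogAroundOne := by
  unfold logLogAroundOne
  refine Continuous.add (by fun_prop) (Continuous.clog (by fun_prop) fun t => ?_)
  have := one_add_mem_slitPlane (r := 1 / 2) (by norm_num) (by norm_num) (norm_exp_neg_angle t)
  push_cast at this
  exact this

theorem exp_pi_mul_I_div_two : Complex.exp (Real.pi * Complex.I / 2) = Complex.I := by
  rw [show (Real.pi * Complex.I / 2 : ℂ) = Real.pi / 2 * Complex.I by ring,
    Complex.exp_mul_I]
  simp

/-- With `e = exp (2 π i t)`, the right side factors as `(2 π / 3) * i * e * (1 + e⁻¹ / 2)`. -/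
theorem exp_logLogAroundOne (t : unitInterval) : Complex.exp (logLogAroundOne t) =
    2 * Real.pi * Complex.I *
      (1 / 6 + 1 / 3 * Complex.exp (2 * Real.pi * Complex.I * (t : ℝ))) := by
  have h := one_add_mem_slitPlane (r := 1 / 2) (by norm_num) (by norm_num) (norm_exp_neg_angle t)
  push_cast at h
  unfold logLogAroundOne
  rw [Complex.exp_add, Complex.exp_add, Complex.exp_add, Complex.exp_log
    (Complex.slitPlane_ne_zero h), ← Complex.ofReal_exp, Real.exp_log (by positivity),
    exp_pi_mul_I_div_two, Complex.exp_neg]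
  have := Complex.exp_ne_zero (2 * Real.pi * Complex.I * (t : ℝ))
  push_cast
  field_simp
  ring

theorem logLogAroundOne_zero :
    logLogAroundOne 0 = Real.log Real.pi + Real.pi * Complex.I / 2 ∧
    logLogAroundOne 1 =
      Real.log Real.pi + Real.pi * Complex.I / 2 + 2 * Real.pi * Complex.I := by
  have hl : (Real.log (2 * Real.pi / 3) : ℂ) + Complex.log (1 + 1 / 2) = Real.log Real.pi := by
    have := Real.pi_pos
    rw [show (1 + 1 / 2 : ℂ) = ((3 / 2 : ℝ) : ℂ) by push_cast; norm_num,
      ← Complex.ofReal_log (by norm_num), ← Complex.ofReal_add,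
      ← Real.log_mul (by positivity) (by norm_num)]
    congr 2
    ring
  constructor
  · simp only [logLogAroundOne, Set.Icc.coe_zero, Complex.ofReal_zero, mul_zero, neg_zero,
      Complex.exp_zero, mul_one, add_zero]
    linear_combination hl
  · simp only [logLogAroundOne, Set.Icc.coe_one, Complex.ofReal_one, mul_one, Complex.exp_neg,
      Complex.exp_two_pi_mul_I, inv_one]
    linear_combination hl

theorem logLogAroundOne_re (t : unitInterval) :
    (logLogAroundOne t).re < Real.log (2 * Real.pi) := by
  have hpi := Real.pi_pos
  rw [Real.lt_log_iff_exp_lt Real.two_pi_pos, ← Complex.norm_exp, exp_logLogAroundOne, norm_mul]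
  have h1 : ‖(2 * Real.pi * Complex.I : ℂ)‖ = 2 * Real.pi := by simp [abs_of_pos hpi]
  have h2 : ‖(1 / 6 + 1 / 3 * Complex.exp (2 * Real.pi * Complex.I * (t : ℝ)) : ℂ)‖ ≤ 1 / 2 := by
    refine (norm_add_le _ _).trans ?_
    rw [norm_mul, norm_exp_angle]
    norm_num
  rw [h1]
  nlinarith

theorem transport_pathZ1 (c : ℂ) :
    transport c (Path.Homotopic.Quotient.mk pathZ1) (baseState c) =
      act c 0 (fun r => if r = 0 then -(2 * Real.pi * Complex.I) else 0) (baseState c) := by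
  have hpi := Real.pi_pos
  set v₁ : ℂ := Real.log Real.pi + Real.pi * Complex.I / 2 with hv₁
  have hexp : Complex.exp v₁ = Real.pi * Complex.I := by
    rw [hv₁, Complex.exp_add, exp_pi_mul_I_div_two, ← Complex.ofReal_exp, Real.exp_log hpi]
  -- These values at `u = π i` make the solution equal to the base state at `v₁`. Around the loop
  -- `u` returns and `v` grows by `2 π i`, so component `j + 1` changes by `-2 π i u ^ j / j!`,
  -- which is the symmetry with only `a 0` nonzero.
  obtain ⟨h, hh, hsol⟩ := exists_isSol_logSol c (Real.pi * Complex.I) (fun j =>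
    (baseState c).val (j + 1) + (Real.pi * Complex.I) ^ j / (j.factorial : ℂ) * v₁)
  have key := transport_of_sol (isOpen_lt Complex.continuous_re continuous_const) hsol
    (fun v _ => (Complex.hasDerivAt_exp v).cexp) pathZ1 logLogAroundOne
    continuous_logLogAroundOne logLogAroundOne_re (fun t => by rw [exp_logLogAroundOne]; rfl)
  rw [logLogAroundOne_zero.1, logLogAroundOne_zero.2, ← hv₁] at key
  have h0 : (⟨fun j => logSol h j v₁⟩ : State) = baseState c := by
    refine State.ext (funext fun j => ?_)
    cases j with
    | zero => rw [baseState_val_zero]; exact hexp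
    | succ j => simp only [logSol, hexp, hh]; ring
  rw [h0] at key
  unfold transport
  rw [key]
  refine State.ext (funext fun j => ?_)
  cases j with
  | zero =>
    simp only [logSol, act, add_zero, baseState_val_zero]
    rw [Complex.exp_add, Complex.exp_two_pi_mul_I, mul_one, hexp]
  | succ j =>
    simp only [logSol, act, baseState_val_zero, Complex.exp_add, Complex.exp_two_pi_mul_I, mul_one,
      hexp, hh, ite_mul, zero_mul, Finset.sum_ite_eq', Finset.mem_range, Nat.succ_pos, if_true,
      mul_zero, Complex.exp_zero, one_mul, Nat.sub_zero]
    ring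

/-! ### The basis on the universal cover and the action of loops -/

/-- The functions `Li_m, b_{m-1}, …, b_0` in terms of the state. -/
def readout (m : ℕ) (c : ℂ) (i : Fin (m + 1)) (v : State) : ℂ :=
  Complex.exp ((1 - c) * v.val 0) *
    if i = 0 then v.val m else v.val 0 ^ (m - (i : ℕ)) / ((m - (i : ℕ)).factorial : ℂ)

/-- The functions `Li_m, b_{m-1}, …, b_0` on the universal cover. -/
def coverBasis (m : ℕ) (c : ℂ) (i : Fin (m + 1)) (p : UniversalCover) : ℂ :=
  readout m c i (transport c p.2 (baseState c))

/-- The matrix through which a symmetry of the differential system acts on the functions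
`Li_m, b_{m-1}, …, b_0`. -/
def actMatrix (m : ℕ) (c ω : ℂ) (a : ℕ → ℂ) : Matrix (Fin (m + 1)) (Fin (m + 1)) ℂ :=
  Matrix.of fun i j =>
    if i = 0 then (if j = 0 then 1 else Complex.exp ((1 - c) * ω) * a ((j : ℕ) - 1))
    else if i ≤ j then
      Complex.exp ((1 - c) * ω) * (ω ^ ((j : ℕ) - (i : ℕ)) / (((j : ℕ) - (i : ℕ)).factorial : ℂ))
    else 0

/-- In row `0` the two exponential factors cancel on `Li_m`, and `a r` multiplies `b_{m-1-r}`, which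
sits in column `r + 1`. The other rows are the binomial expansion of `(log z + ω) ^ (m - i)`. -/
theorem readout_act (m : ℕ) (hm : 1 ≤ m) (c ω : ℂ) (a : ℕ → ℂ) (i : Fin (m + 1)) (v : State) :
    readout m c i (act c ω a v) = ∑ j, actMatrix m c ω a i j * readout m c j v := by
  have h0 : (act c ω a v).val 0 = v.val 0 + ω := rfl
  have hq : Complex.exp ((1 - c) * (v.val 0 + ω)) =
      Complex.exp ((1 - c) * v.val 0) * Complex.exp ((1 - c) * ω) := by
    rw [← Complex.exp_add]; congr 1; ring
  by_cases hi : i = 0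
  · subst hi
    obtain ⟨m, rfl⟩ := Nat.exists_eq_add_of_le' hm
    have h1 : Complex.exp ((1 - c) * ω) * Complex.exp ((c - 1) * ω) = 1 := by
      rw [← Complex.exp_add, show (1 - c) * ω + (c - 1) * ω = 0 by ring, Complex.exp_zero]
    rw [Fin.sum_univ_succ]
    simp only [readout, actMatrix, Matrix.of_apply, if_true, hq, Fin.succ_ne_zero, if_false,
      Fin.val_succ, Nat.add_sub_cancel, Nat.add_sub_add_right, act]
    rw [Finset.sum_range, mul_add, Finset.mul_sum]
    congr 1
    · linear_combination Complex.exp ((1 - c) * v.val 0) * v.val (m + 1) * h1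
    · exact Finset.sum_congr rfl fun r _ => by ring
  · simp only [readout, actMatrix, Matrix.of_apply, if_neg hi, h0, hq]
    let f : ℕ → ℂ := fun j => if (i : ℕ) ≤ j then Complex.exp ((1 - c) * v.val 0) *
      Complex.exp ((1 - c) * ω) * (ω ^ (j - (i : ℕ)) / ((j - (i : ℕ)).factorial : ℂ) *
        (v.val 0 ^ (m - j) / ((m - j).factorial : ℂ))) else 0
    have hsum : ∀ j : Fin (m + 1), (if i ≤ j then Complex.exp ((1 - c) * ω) *
        (ω ^ ((j : ℕ) - (i : ℕ)) / (((j : ℕ) - (i : ℕ)).factorial : ℂ)) else 0) *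
        (Complex.exp ((1 - c) * v.val 0) * if j = 0 then v.val m else
          v.val 0 ^ (m - (j : ℕ)) / ((m - (j : ℕ)).factorial : ℂ)) = f j := by
      intro j
      simp only [f, Fin.le_def]
      split_ifs with h1 h2
      · exfalso
        apply hi
        rw [h2] at h1
        exact Fin.ext (by simpa using h1)
      · ring
      · rw [zero_mul]
      · rw [zero_mul]
    have hil : (i : ℕ) ≤ m := Nat.lt_succ_iff.mp i.2
    rw [Finset.sum_congr rfl fun j _ => hsum j, ← Finset.sum_range f,
      congrArg (fun n => ∑ j ∈ Finset.range n, f j)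
        (show m + 1 = (i : ℕ) + (m - i + 1) by omega), Finset.sum_range_add, add_comm (v.val 0) ω,
      add_pow_div_factorial, Finset.mul_sum,
      Finset.sum_eq_zero (s := Finset.range i) (f := f)
        (fun j hj => if_neg (by simpa using hj)), zero_add]
    refine Finset.sum_congr rfl fun r _ => ?_
    simp only [f]
    rw [if_pos (Nat.le_add_right _ _), Nat.add_sub_cancel_left, Nat.sub_sub]

/-- The homotopy class of loops underlying an element of the fundamental group. -/
def loop (τ : LoopGroup) : Path.Homotopic.Quotient base base := FundamentalGroup.toPath τ.unop

theorem translate_coverBasis {m : ℕ} (hm : 1 ≤ m) {c ω : ℂ} {a : ℕ → ℂ} {τ : LoopGroup}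
    (h : transport c (loop τ) (baseState c) = act c ω a (baseState c)) (i : Fin (m + 1)) :
    translate τ (coverBasis m c i) = ∑ j, actMatrix m c ω a i j • coverBasis m c j := by
  funext p
  have h1 : translate τ (coverBasis m c i) p =
      readout m c i (transport c ((loop τ).trans p.2) (baseState c)) := rfl
  -- The symmetry produced by the loop at the base point passes through transport along the rest of
  -- the path.
  rw [h1, transport_trans, h, transport_act, readout_act m hm]
  simp [coverBasis]

/-- Symmetries are transitive on states, and the first components before and after the loop are both
logarithms of `-1`. No generators of the fundamental group are needed. -/
theorem exists_transport_loop_eq (c : ℂ) (τ : LoopGroup) : ∃ (n : ℤ) (a : ℕ → ℂ),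
    transport c (loop τ) (baseState c) = act c (n * (2 * Real.pi * Complex.I)) a (baseState c) := by
  obtain ⟨a, ha⟩ := exists_act_eq c (baseState c) (transport c (loop τ) (baseState c))
  have h1 : Complex.exp ((baseState c).val 0) = (base : ℂ) := by
    rw [baseState_val_zero]; exact exp_log_base
  have h2 := exp_transport c (loop τ) (baseState c) h1
  obtain ⟨n, hn⟩ := Complex.exp_eq_exp_iff_exists_int.mp (h2.trans h1.symm)
  refine ⟨n, a, ?_⟩
  rw [← ha, hn]
  congr 1
  ring

theorem transport_Z0 (c : ℂ) : transport c (loop Z0) (baseState c) =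
    act c (2 * Real.pi * Complex.I)
      (fun r => eps c * ((2 * Real.pi * Complex.I) ^ (r + 1) / ((r + 1).factorial : ℂ)))
      (baseState c) := transport_pathZ0 c

theorem transport_Z1 (c : ℂ) : transport c (loop Z1) (baseState c) =
    act c 0 (fun r => if r = 0 then -(2 * Real.pi * Complex.I) else 0) (baseState c) :=
  transport_pathZ1 c

theorem IsSol.differentiableOn {c : ℂ} {φ φ' : ℂ → ℂ} {s : ℕ → ℂ → ℂ} {W : Set ℂ}
    (h : IsSol c φ φ' s W) (j : ℕ) : DifferentiableOn ℂ (s j) W := by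
  intro w hw
  refine DifferentiableAt.differentiableWithinAt ?_
  match j with
  | 0 => exact (h.zero w hw).differentiableAt
  | 1 => exact (h.one w hw).differentiableAt
  | j + 2 => exact (h.succ j w hw).differentiableAt

theorem isHolomorphic_coverBasis (m : ℕ) (c : ℂ) (i : Fin (m + 1)) :
    IsHolomorphic (coverBasis m c i) := by
  rintro ⟨z, γ⟩
  set v := transport c γ (baseState c) with hv
  have hs := isSol_localSol c z z v.val
  refine ⟨rad z, rad_pos z, fun w => readout m c i ⟨fun j => localSol c z z v.val j w⟩, ?_, ?_⟩
  · have h0 := hs.differentiableOn 0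
    refine DifferentiableOn.mul (h0.const_mul _).cexp ?_
    split_ifs
    · exact hs.differentiableOn m
    · exact (h0.pow _).div_const _
  · intro w δ hδ
    have key := transport_of_sol (isOpen_disc z) hs (fun u _ => hasDerivAt_id u) δ
      (fun t => (δ t : ℂ)) (continuous_subtype_val.comp δ.continuous) hδ (fun t => rfl)
    simp only [Path.source, Path.target, localSol_self] at key
    simp only [coverBasis, transport_trans, ← hv]
    rw [← key]
    rfl

theorem isContinuation_coverBasis {m : ℕ} {c : ℂ} {i : Fin (m + 1)} {f : ℂ → ℂ}
    (hf : ∀ z : ℂ, ‖z‖ < 1 → 0 < z.im → f z = readout m c i (seriesState c (Complex.log z))) :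
    IsContinuation f (coverBasis m c i) := by
  refine ⟨isHolomorphic_coverBasis m c i, fun z γ h => ?_⟩
  obtain ⟨w, hw⟩ := exists_isLift_log γ h
  have hz := h 1 one_pos
  rw [γ.target] at hz
  have hb : (Complex.log z).re < 0 := by
    rw [Complex.log_re]
    exact Real.log_neg (norm_pos_iff.mpr z.2.1) hz.1
  rw [hf _ hz.1 hz.2]
  simp only [coverBasis]
  rw [transport_baseState c hw hb]

theorem readout_seriesState {m : ℕ} (hm : 1 ≤ m) (c : ℂ) (i : Fin (m + 1)) {z : ℂ} (hz : z ≠ 0) :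
    readout m c i (seriesState c (Complex.log z)) =
      if i = 0 then deformedPolylog m c z + eps c * powerLog m c z
      else powerLog (m - (i : ℕ)) c z := by
  have hcpow : z ^ (1 - c) = Complex.exp ((1 - c) * Complex.log z) := by
    rw [Complex.cpow_def_of_ne_zero hz, mul_comm]
  simp only [readout, seriesState, powerLog, hcpow]
  split_ifs
  · obtain ⟨m, rfl⟩ := Nat.exists_eq_add_of_le' hm
    have h1 : Complex.exp ((1 - c) * Complex.log z) * Complex.exp (c * Complex.log z) = z := by
      rw [← Complex.exp_add, show (1 - c) * Complex.log z + c * Complex.log z = Complex.log z by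
        ring, Complex.exp_log hz]
    have h2 : deformedPolylog (m + 1) c z = z * expSeries c (m + 1) (Complex.log z) := by
      rw [deformedPolylog, expSeries, ← tsum_mul_left]
      refine tsum_congr fun n => ?_
      rw [Complex.exp_nat_mul, Complex.exp_log hz]
      ring
    simp only [seriesSol, h2]
    linear_combination expSeries c (m + 1) (Complex.log z) * h1
  · simp only [seriesSol]
    ring

theorem eps_of_forall_ne {c : ℂ} (hc : ∀ l : ℕ, c ≠ -(l : ℂ)) : eps c = 0 := by
  rw [eps, if_neg]
  rintro ⟨k, hk⟩
  exact hc k (by linear_combination hk)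

theorem eps_neg_natCast (k : ℕ) : eps (-(k : ℂ)) = 1 := by
  rw [eps, if_pos ⟨k, by ring⟩]

theorem isContinuation_generalBasis {m : ℕ} (hm : 1 ≤ m) {c : ℂ} (hc : ∀ l : ℕ, c ≠ -(l : ℂ))
    (i : Fin (m + 1)) : IsContinuation (generalBasis m c i) (coverBasis m c i) := by
  refine isContinuation_coverBasis fun z _ hz => ?_
  rw [readout_seriesState hm c i (by rintro rfl; simp at hz), eps_of_forall_ne hc]
  simp [generalBasis]

theorem isContinuation_modifiedBasis {m : ℕ} (hm : 1 ≤ m) (k : ℕ) (i : Fin (m + 1)) :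
    IsContinuation (modifiedBasis m k i) (coverBasis m (-(k : ℂ)) i) := by
  refine isContinuation_coverBasis fun z _ hz => ?_
  have hz0 : z ≠ 0 := by rintro rfl; simp at hz
  rw [readout_seriesState hm _ i hz0, eps_neg_natCast, modifiedBasis, one_mul]
  congr 1
  rw [modifiedPolylog, deformedPolylog, powerLog]
  congr 1
  · refine tsum_congr fun n => ?_
    split_ifs with h
    -- The unmodified series already omits the resonant term: `m ≥ 1` makes its denominator `0`, and
    -- division by `0` gives `0`.
    · rw [h, add_neg_cancel, zero_pow (by omega), div_zero]
    · rw [sub_eq_add_neg]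
  · rw [show (1 - -(k : ℂ)) = ((k + 1 : ℕ) : ℂ) by push_cast; ring, Complex.cpow_natCast]

/-! ### The identity theorem on the universal cover -/

/-- `F` vanishes near the point `p` of the universal cover. -/
def VanishesNear (F : UniversalCover → ℂ) (p : UniversalCover) : Prop :=
  ∃ r : ℝ, 0 < r ∧ ∀ (w : PuncturedPlane) (δ : Path p.1 w),
    (∀ t, ((δ t : PuncturedPlane) : ℂ) ∈ Metric.ball (p.1 : ℂ) r) →
      F ⟨w, p.2.trans (Path.Homotopic.Quotient.mk δ)⟩ = 0

theorem exists_segment {x y : PuncturedPlane}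
    (h : ∀ u ∈ segment ℝ (x : ℂ) y, u ≠ 0 ∧ u ≠ 1) :
    ∃ γ : Path x y, ∀ t, (γ t : ℂ) = Path.segment (x : ℂ) y t := by
  have hm : ∀ t, Path.segment (x : ℂ) y t ≠ 0 ∧ Path.segment (x : ℂ) y t ≠ 1 := fun t =>
    h _ (by rw [← Path.range_segment]; exact ⟨t, rfl⟩)
  exact ⟨⟨⟨fun t => ⟨Path.segment (x : ℂ) y t, hm t⟩,
    (Path.segment (x : ℂ) y).continuous.subtype_mk _⟩, Subtype.ext (by simp),
    Subtype.ext (by simp)⟩, fun t => rfl⟩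

theorem vanishesNear_of_germ {F : UniversalCover → ℂ} {p : UniversalCover} {r : ℝ} (hr : 0 < r)
    {g : ℂ → ℂ} (hg : DifferentiableOn ℂ g (Metric.ball (p.1 : ℂ) r))
    (hFg : ∀ (w : PuncturedPlane) (δ : Path p.1 w),
      (∀ t, ((δ t : PuncturedPlane) : ℂ) ∈ Metric.ball (p.1 : ℂ) r) →
        F ⟨w, p.2.trans (Path.Homotopic.Quotient.mk δ)⟩ = g (w : ℂ))
    {O : Set ℂ} (hO : IsOpen O) {z : ℂ} (hz : z ∈ O) (hOr : O ⊆ Metric.ball (p.1 : ℂ) r)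
    (hO0 : ∀ w ∈ O, g w = 0) : VanishesNear F p := by
  refine ⟨r, hr, fun w δ hδ => ?_⟩
  rw [hFg w δ hδ]
  have hw : (w : ℂ) ∈ Metric.ball (p.1 : ℂ) r := by simpa using hδ 1
  exact (hg.analyticOnNhd Metric.isOpen_ball).eqOn_zero_of_preconnected_of_eventuallyEq_zero
    (convex_ball _ _).isPreconnected (hOr hz) (by
      filter_upwards [hO.mem_nhds hz] with u hu using hO0 u hu) hw

theorem vanishesNear_base {F : UniversalCover → ℂ} (hF : IsHolomorphic F)
    (h0 : ∀ (z : PuncturedPlane) (γ : Path base z),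
      (∀ t, 0 < t → ‖((γ t : PuncturedPlane) : ℂ)‖ < 1 ∧ 0 < ((γ t : PuncturedPlane) : ℂ).im) →
        F ⟨z, Path.Homotopic.Quotient.mk γ⟩ = 0) :
    VanishesNear F ⟨base, Path.Homotopic.Quotient.refl base⟩ := by
  obtain ⟨r, hr, g, hg, hFg⟩ := hF ⟨base, Path.Homotopic.Quotient.refl base⟩
  set O : Set ℂ := Metric.ball (-1 : ℂ) r ∩ (Metric.ball 0 1 ∩ {z | 0 < z.im}) with hO
  have hOo : IsOpen O := Metric.isOpen_ball.inter
    (Metric.isOpen_ball.inter (isOpen_lt continuous_const Complex.continuous_im))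
  obtain ⟨ε, hε0, hε1, hεr⟩ : ∃ ε : ℝ, 0 < ε ∧ ε < 1 ∧ 2 * ε < r :=
    ⟨min (1 / 2) (r / 3), by positivity, (min_le_left _ _).trans_lt (by norm_num),
      by have := min_le_right (1 / 2) (r / 3); linarith⟩
  -- This point near `-1` lies in the half disc: its squared modulus is `1 - 2 ε + 2 ε ^ 2 < 1`.
  refine vanishesNear_of_germ hr hg hFg hOo (z := -1 + ε * (1 + Complex.I)) ⟨?_, ?_, ?_⟩
    Set.inter_subset_left fun z hz => ?_
  · rw [mem_ball_iff_norm, add_sub_cancel_left, norm_mul, Complex.norm_real, Real.norm_eq_abs,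
      abs_of_pos hε0]
    have : ‖(1 + Complex.I : ℂ)‖ ≤ 2 := (norm_add_le _ _).trans (by simp; norm_num)
    nlinarith
  · rw [mem_ball_zero_iff, ← sq_lt_one_iff₀ (norm_nonneg _), Complex.sq_norm, Complex.normSq_apply]
    simp
    nlinarith
  · simpa using hε0
  · obtain ⟨hzr, hz1, hz2⟩ := hz
    rw [mem_ball_zero_iff] at hz1
    change 0 < z.im at hz2
    have hseg : ∀ t : unitInterval, 0 < t → ‖Path.segment (-1 : ℂ) z t‖ < 1 ∧
        0 < (Path.segment (-1 : ℂ) z t).im := by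
      intro t ht
      have ht' : (0 : ℝ) < t := ht
      rw [Path.segment_apply, AffineMap.lineMap_apply_module]
      constructor
      · refine (norm_add_le _ _).trans_lt ?_
        rw [norm_smul, norm_smul, norm_neg, norm_one, Real.norm_eq_abs, Real.norm_eq_abs,
          abs_of_pos ht', abs_of_nonneg (by linarith [t.2.2])]
        nlinarith
      · simpa using mul_pos ht' hz2
    have hz0 : z ≠ 0 ∧ z ≠ 1 := by constructor <;> rintro rfl <;> simp at hz2
    obtain ⟨γ, hγ⟩ := exists_segment (x := base) (y := ⟨z, hz0⟩) (by
      intro u hu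
      change u ∈ segment ℝ (-1 : ℂ) z at hu
      rw [← Path.range_segment] at hu
      obtain ⟨t, rfl⟩ := hu
      rcases eq_or_lt_of_le (unitInterval.nonneg' (t := t)) with rfl | ht
      · rw [Path.source]; norm_num
      · have := (hseg t ht).2
        constructor <;> intro h <;> rw [h] at this <;> simp at this)
    have h1 := hFg ⟨z, hz0⟩ γ (by
      intro t
      rw [hγ]
      refine (convex_ball _ _).segment_subset (Metric.mem_ball_self hr) hzr ?_
      rw [← Path.range_segment]
      exact ⟨t, rfl⟩)
    rw [Path.Homotopic.Quotient.refl_trans, h0 _ γ fun t ht => by rw [hγ]; exact hseg t ht] at h1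
    exact h1.symm

theorem mk_cast_trans {X : Type*} [TopologicalSpace X] {a b d x : X} {q₁ : Path a b}
    {q₂ : Path b d} {q₃ : Path a d} (h : Path.Homotopic (q₁.trans q₂) q₃) (hx : x = a) :
    (Path.Homotopic.Quotient.mk (q₁.cast hx rfl)).trans (Path.Homotopic.Quotient.mk q₂) =
      Path.Homotopic.Quotient.mk (q₃.cast hx rfl) := by
  subst hx
  exact Path.Homotopic.Quotient.eq.mpr h

theorem mk_cast_trans_refl {X : Type*} [TopologicalSpace X] {a b x z : X} (q : Path a b)
    (hx : x = a) (hz : z = b) : (Path.Homotopic.Quotient.mk (q.cast hx rfl)).trans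
      (Path.Homotopic.Quotient.mk ((Path.refl b).cast rfl hz)) =
      Path.Homotopic.Quotient.mk (q.cast hx hz) := by
  subst hx hz
  exact Path.Homotopic.Quotient.trans_refl _

/-- The homotopy class of the restriction of a path to `[0, t]`. -/
def initialClass {z : PuncturedPlane} (γ : Path base z) (t : unitInterval) :
    Path.Homotopic.Quotient base (γ t) :=
  Path.Homotopic.Quotient.mk ((γ.subpath 0 t).cast γ.source.symm rfl)

/-- The restriction of a path to `[0, t]`, as a point of the universal cover. -/
def initialPart {z : PuncturedPlane} (γ : Path base z) (t : unitInterval) : UniversalCover :=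
  ⟨γ t, initialClass γ t⟩

theorem initialClass_trans {z w : PuncturedPlane} (γ : Path base z) (t s : unitInterval)
    (δ : Path (γ s) w) : (initialClass γ s).trans (Path.Homotopic.Quotient.mk δ) =
      (initialClass γ t).trans (Path.Homotopic.Quotient.mk ((γ.subpath t s).trans δ)) := by
  rw [Path.Homotopic.Quotient.mk_trans, ← Path.Homotopic.Quotient.trans_assoc]
  congr 1
  exact (mk_cast_trans ⟨Path.Homotopy.subpathTransSubpath γ 0 t s⟩ γ.source.symm).symm

theorem eventually_subpath_mem {z : PuncturedPlane} (γ : Path base z) (t : unitInterval) {r : ℝ}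
    (hr : 0 < r) : ∀ᶠ s in 𝓝 t, (γ s : ℂ) ∈ Metric.ball (γ t : ℂ) r ∧
      ∀ u, (γ.subpath t s u : ℂ) ∈ Metric.ball (γ t : ℂ) r := by
  have hγ : ContinuousAt (fun t => (γ t : ℂ)) t :=
    continuous_subtype_val.continuousAt.comp γ.continuous.continuousAt
  obtain ⟨ε, hε, hb⟩ := Metric.eventually_nhds_iff.mp
    (hγ.eventually (Metric.ball_mem_nhds (γ t : ℂ) hr))
  refine Metric.eventually_nhds_iff.mpr ⟨ε, hε, fun s hs => ⟨hb hs, fun u => ?_⟩⟩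
  have hu : γ.subpath t s u ∈ Set.range (γ.subpath t s) := ⟨u, rfl⟩
  rw [Path.range_subpath] at hu
  obtain ⟨y, hy, hyu⟩ := hu
  rw [← hyu]
  refine hb (lt_of_le_of_lt ?_ hs)
  have hy' : (y : ℝ) ∈ Set.uIcc (t : ℝ) s := by
    simpa [Set.mem_uIcc] using hy
  rw [dist_comm y t, dist_comm s t]
  exact Real.dist_left_le_of_mem_uIcc hy'

theorem forall_trans_mem {x y w : PuncturedPlane} {q : Path x y} {δ : Path y w} {B : Set ℂ}
    (hq : ∀ u, (q u : ℂ) ∈ B) (hδ : ∀ u, (δ u : ℂ) ∈ B) (u : unitInterval) :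
    (q.trans δ u : ℂ) ∈ B := by
  rw [Path.trans_apply]
  split_ifs
  · exact hq _
  · exact hδ _

theorem VanishesNear.eventually {F : UniversalCover → ℂ} {z : PuncturedPlane} {γ : Path base z}
    {t : unitInterval} (h : VanishesNear F (initialPart γ t)) :
    ∀ᶠ s in 𝓝 t, VanishesNear F (initialPart γ s) := by
  obtain ⟨r, hr, hv⟩ := h
  filter_upwards [eventually_subpath_mem γ t hr] with s hs
  obtain ⟨ρ, hρ, hsub⟩ := Metric.isOpen_iff.mp Metric.isOpen_ball _ hs.1
  refine ⟨ρ, hρ, fun w δ hδ => ?_⟩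
  exact (congrArg (fun q => F ⟨w, q⟩) (initialClass_trans γ t s δ)).trans
    (hv w _ (forall_trans_mem hs.2 fun u => hsub (hδ u)))

theorem eventually_vanishesNear_imp {F : UniversalCover → ℂ} (hF : IsHolomorphic F)
    {z : PuncturedPlane} (γ : Path base z) (t : unitInterval) :
    ∀ᶠ s in 𝓝 t, VanishesNear F (initialPart γ s) → VanishesNear F (initialPart γ t) := by
  obtain ⟨r, hr, g, hg, hFg⟩ := hF (initialPart γ t)
  filter_upwards [eventually_subpath_mem γ t hr] with s hs
  rintro ⟨ρ, hρ, hv⟩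
  set O : Set ℂ := Metric.ball (γ s : ℂ) ρ ∩ disc (γ s) ∩ Metric.ball (γ t : ℂ) r with hO
  have hsO : (γ s : ℂ) ∈ O := ⟨⟨Metric.mem_ball_self hρ, mem_disc_self _⟩, hs.1⟩
  have hconv : Convex ℝ O := ((convex_ball _ _).inter (convex_disc _)).inter (convex_ball _ _)
  refine vanishesNear_of_germ hr hg hFg
    ((Metric.isOpen_ball.inter (isOpen_disc _)).inter Metric.isOpen_ball) hsO
    Set.inter_subset_right fun w hw => ?_
  obtain ⟨δ, hδ⟩ := exists_segment (x := γ s) (y := ⟨w, ne_of_mem_disc hw.1.2⟩) fun u hu =>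
    ne_of_mem_disc (hconv.segment_subset hsO hw hu).1.2
  have hδO : ∀ u, (δ u : ℂ) ∈ O := by
    intro u
    rw [hδ]
    refine hconv.segment_subset hsO hw ?_
    rw [← Path.range_segment]
    exact ⟨u, rfl⟩
  have h1 := hFg _ _ (forall_trans_mem hs.2 fun u => (hδO u).2)
  exact h1.symm.trans ((congrArg (fun q => F ⟨_, q⟩) (initialClass_trans γ t s δ).symm).trans
    (hv _ δ fun u => (hδO u).1.1))

/-- Along a path, vanishing near the initial part up to `t` is an open and closed condition on `t`;
it holds at `t = 0`, hence at `t = 1`. -/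
theorem eq_zero_of_isHolomorphic {F : UniversalCover → ℂ} (hF : IsHolomorphic F)
    (h0 : ∀ (z : PuncturedPlane) (γ : Path base z),
      (∀ t, 0 < t → ‖((γ t : PuncturedPlane) : ℂ)‖ < 1 ∧ 0 < ((γ t : PuncturedPlane) : ℂ).im) →
        F ⟨z, Path.Homotopic.Quotient.mk γ⟩ = 0) : F = 0 := by
  funext ⟨z, γ⟩
  obtain ⟨γ⟩ := γ
  have hstart : initialPart γ 0 = ⟨base, Path.Homotopic.Quotient.refl base⟩ := by
    have aux : ∀ (a : PuncturedPlane) (hx : base = a), (⟨a, Path.Homotopic.Quotient.mk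
        ((Path.refl a).cast hx rfl)⟩ : UniversalCover) =
        ⟨base, Path.Homotopic.Quotient.refl base⟩ := by
      rintro a rfl; rfl
    rw [initialPart, initialClass, Path.subpath_self]
    exact aux _ γ.source.symm
  have hconst := eq_of_eventually_eq (fun t => VanishesNear F (initialPart γ t)) (by
    intro t
    by_cases h : VanishesNear F (initialPart γ t)
    · filter_upwards [h.eventually] with s hs
      exact propext ⟨fun _ => h, fun _ => hs⟩
    · filter_upwards [eventually_vanishesNear_imp hF γ t] with s hs
      exact propext ⟨hs, fun h' => absurd h' h⟩)
  have hend : VanishesNear F (initialPart γ 1) := by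
    rw [← hconst, hstart]
    exact vanishesNear_base hF h0
  obtain ⟨r, hr, hv⟩ := hend
  have h1 := hv z ((Path.refl (γ 1)).cast rfl γ.target.symm) fun t => Metric.mem_ball_self hr
  have h2 : (initialPart γ 1).2.trans
      (Path.Homotopic.Quotient.mk ((Path.refl (γ 1)).cast rfl γ.target.symm)) =
      Path.Homotopic.Quotient.mk γ := by
    refine (mk_cast_trans_refl (γ.subpath 0 1) γ.source.symm γ.target.symm).trans ?_
    congr 1
    rw [Path.subpath_zero_one]
    rfl
  rw [h2] at h1
  exact h1

theorem IsHolomorphic.sub {F G : UniversalCover → ℂ} (hF : IsHolomorphic F)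
    (hG : IsHolomorphic G) : IsHolomorphic (F - G) := by
  intro p
  obtain ⟨r, hr, f, hf, hFf⟩ := hF p
  obtain ⟨s, hs, g, hg, hGg⟩ := hG p
  refine ⟨min r s, lt_min hr hs, f - g,
    (hf.mono (Metric.ball_subset_ball (min_le_left _ _))).sub
      (hg.mono (Metric.ball_subset_ball (min_le_right _ _))), fun w δ hδ => ?_⟩
  rw [Pi.sub_apply, Pi.sub_apply,
    hFf w δ fun t => Metric.ball_subset_ball (min_le_left _ _) (hδ t),
    hGg w δ fun t => Metric.ball_subset_ball (min_le_right _ _) (hδ t)]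

theorem IsContinuation.unique {f : ℂ → ℂ} {F G : UniversalCover → ℂ} (hF : IsContinuation f F)
    (hG : IsContinuation f G) : F = G := by
  rw [← sub_eq_zero]
  refine eq_zero_of_isHolomorphic (hF.1.sub hG.1) fun z γ h => ?_
  rw [Pi.sub_apply, hF.2 z γ h, hG.2 z γ h, sub_self]

/-! ### Linear independence -/

theorem readout_act_zero {m : ℕ} (hm : 1 ≤ m) (c x : ℂ) (i : Fin (m + 1)) (v : State) :
    readout m c i (act c 0 (fun r => if r = 0 then x else 0) v) = readout m c i v +
      if i = 0 then
        Complex.exp ((1 - c) * v.val 0) * (x * (v.val 0 ^ (m - 1) / ((m - 1).factorial : ℂ)))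
      else 0 := by
  obtain ⟨m, rfl⟩ := Nat.exists_eq_add_of_le' hm
  by_cases hi : i = 0
  · simp only [readout, act, hi, if_true, add_zero, mul_zero, Complex.exp_zero, one_mul, ite_mul,
      zero_mul, Finset.sum_ite_eq', Finset.mem_range, Nat.succ_pos, Nat.sub_zero,
      Nat.add_sub_cancel, mul_add]
  · simp only [readout, act, if_neg hi, add_zero]

theorem eq_zero_of_forall_sum_pow {m : ℕ} {x : Fin (m + 1) → ℂ}
    (h : ∀ b : ℂ, b.re < 0 →
      ∑ i, x i * (b ^ (m - (i : ℕ)) / ((m - (i : ℕ)).factorial : ℂ)) = 0) (i : Fin (m + 1)) :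
    x i = 0 := by
  set P : Polynomial ℂ := ∑ i : Fin (m + 1),
    Polynomial.C (x i / ((m - (i : ℕ)).factorial : ℂ)) * Polynomial.X ^ (m - (i : ℕ)) with hP
  have hP0 : P = 0 := by
    refine Polynomial.eq_zero_of_infinite_isRoot P
      (Set.infinite_of_injective_forall_mem (f := fun n : ℕ => -((n : ℂ) + 1)) ?_ fun n => ?_)
    · intro a b hab
      simpa using hab
    · have := h (-((n : ℂ) + 1)) (by simp; linarith [n.cast_nonneg (α := ℝ)])
      change Polynomial.IsRoot P _
      rw [Polynomial.IsRoot, hP, Polynomial.eval_finsetSum, ← this]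
      refine Finset.sum_congr rfl fun j _ => ?_
      simp only [Polynomial.eval_mul, Polynomial.eval_C, Polynomial.eval_pow, Polynomial.eval_X]
      ring
  have hc := congrArg (fun Q => Polynomial.coeff Q (m - (i : ℕ))) hP0
  simp only [hP, Polynomial.finsetSum_coeff, Polynomial.coeff_C_mul_X_pow,
    Polynomial.coeff_zero] at hc
  rw [Finset.sum_eq_single i, if_pos rfl] at hc
  · have h1 : ((m - (i : ℕ)).factorial : ℂ) ≠ 0 := by exact_mod_cast Nat.factorial_ne_zero _
    exact (div_eq_zero_iff.mp hc).resolve_right h1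
  · intro j _ hj
    rw [if_neg]
    intro h1
    apply hj
    have := i.2
    have := j.2
    exact Fin.ext (by omega)
  · intro h1
    exact absurd (Finset.mem_univ i) h1

theorem linearIndependent_coverBasis {m : ℕ} (hm : 1 ≤ m) (c : ℂ) :
    LinearIndependent ℂ (coverBasis m c) := by
  rw [Fintype.linearIndependent_iff]
  intro x hx
  have hx' : ∀ p : UniversalCover,
      ∑ i, x i * readout m c i (transport c p.2 (baseState c)) = 0 := by
    intro p
    simpa [coverBasis] using congrFun hx p
  have h1 : ∀ b : ℂ, b.re < 0 → ∑ i, x i * readout m c i (seriesState c b) = 0 := by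
    intro b hb
    obtain ⟨γ, w, hw⟩ := exists_isLift_segment hb
    rw [← transport_baseState c hw hb]
    exact hx' ⟨_, Path.Homotopic.Quotient.mk γ⟩
  have h2 : x 0 = 0 := by
    have hb : (-1 : ℂ).re < 0 := by simp
    obtain ⟨γ, w, hw⟩ := exists_isLift_segment hb
    -- Continued along `Z₁` first, the relation changes only by `x 0 * (-2 π i) * b_{m-1}`, and
    -- `b_{m-1}` is nonzero at `w = -1`.
    have h3 := hx' ⟨_, (loop Z1).trans (Path.Homotopic.Quotient.mk γ)⟩
    simp only at h3
    rw [transport_trans, transport_Z1, transport_act, transport_baseState c hw hb] at h3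
    simp only [readout_act_zero hm, mul_add, Finset.sum_add_distrib, h1 _ hb, zero_add, mul_ite,
      mul_zero, Finset.sum_ite_eq', Finset.mem_univ, if_true] at h3
    have h4 : ((m - 1).factorial : ℂ) ≠ 0 := by exact_mod_cast Nat.factorial_ne_zero _
    have h5 : (seriesState c (-1)).val 0 ≠ 0 := by simp [seriesState, seriesSol]
    refine (mul_eq_zero.mp h3).resolve_right ?_
    exact mul_ne_zero (Complex.exp_ne_zero _) (mul_ne_zero
      (neg_ne_zero.mpr Complex.two_pi_I_ne_zero) (div_ne_zero (pow_ne_zero _ h5) h4))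
  refine eq_zero_of_forall_sum_pow fun b hb => ?_
  have h3 := h1 b hb
  have h4 : ∀ i, x i * readout m c i (seriesState c b) = Complex.exp ((1 - c) * b) *
      (x i * (b ^ (m - (i : ℕ)) / ((m - (i : ℕ)).factorial : ℂ))) := by
    intro i
    simp only [readout, seriesState, seriesSol]
    split_ifs with hi
    · rw [hi, h2]; simp
    · ring
  rw [Finset.sum_congr rfl fun i _ => h4 i, ← Finset.mul_sum] at h3
  exact (mul_eq_zero.mp h3).resolve_left (Complex.exp_ne_zero _)

/-! ### The monodromy representation and its uniqueness -/

theorem matrix_eq_of_sum_smul_eq {n : ℕ} {B : Fin n → UniversalCover → ℂ}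
    (hB : LinearIndependent ℂ B) {M N : Matrix (Fin n) (Fin n) ℂ}
    (h : ∀ i, ∑ j, M i j • B j = ∑ j, N i j • B j) : M = N := by
  ext i j
  exact Fintype.linearIndependent_iffₛ.mp hB (M i) (N i) (h i) j

theorem translate_one (F : UniversalCover → ℂ) : translate 1 F = F := by
  funext p
  change F ⟨p.1, (Path.Homotopic.Quotient.refl base).trans p.2⟩ = F p
  rw [Path.Homotopic.Quotient.refl_trans]

/-- The reversal of order here is what makes `Q_τ B = ρ(τ) B` a homomorphism: `Q_τ` acts on the
functions in `Q_σ B = ρ(σ) B` and leaves the constants, giving `ρ(σ) ρ(τ) B`. -/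
theorem translate_mul (σ τ : LoopGroup) (F : UniversalCover → ℂ) :
    translate (σ * τ) F = translate τ (translate σ F) := by
  funext p
  change F ⟨p.1, ((loop σ).trans (loop τ)).trans p.2⟩ = F ⟨p.1, (loop σ).trans ((loop τ).trans p.2)⟩
  rw [Path.Homotopic.Quotient.trans_assoc]

theorem translate_sum_smul {n : ℕ} (τ : LoopGroup) (x : Fin n → ℂ)
    (B : Fin n → UniversalCover → ℂ) :
    translate τ (∑ j, x j • B j) = ∑ j, x j • translate τ (B j) := by
  funext p
  simp [translate]

theorem exists_representation {n : ℕ} {B : Fin n → UniversalCover → ℂ}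
    (hB : LinearIndependent ℂ B)
    (h : ∀ τ, ∃ M : Matrix (Fin n) (Fin n) ℂ, ∀ i, translate τ (B i) = ∑ j, M i j • B j) :
    ∃ ρ : LoopGroup →* GL (Fin n) ℂ, ∀ τ i, translate τ (B i) =
      ∑ j, ((ρ τ : GL (Fin n) ℂ) : Matrix (Fin n) (Fin n) ℂ) i j • B j := by
  choose M hM using h
  have h1 : M 1 = 1 := matrix_eq_of_sum_smul_eq hB fun i => by
    rw [← hM, translate_one]
    simp [Matrix.one_apply]
  have h2 : ∀ σ τ, M (σ * τ) = M σ * M τ := fun σ τ => matrix_eq_of_sum_smul_eq hB fun i => by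
    rw [← hM, translate_mul, hM σ, translate_sum_smul]
    simp only [hM τ, Finset.smul_sum, smul_smul, Matrix.mul_apply, Finset.sum_smul]
    exact Finset.sum_comm
  exact ⟨MonoidHom.toHomUnits ⟨⟨M, h1⟩, h2⟩, fun τ i => hM τ i⟩

theorem IsMonodromyRep.unique {n : ℕ} {f : Fin n → ℂ → ℂ} {ρ ρ' : LoopGroup →* GL (Fin n) ℂ}
    (h : IsMonodromyRep f ρ) (h' : IsMonodromyRep f ρ') : ρ = ρ' := by
  obtain ⟨B, hB, hli, hρ⟩ := h
  obtain ⟨B', hB', -, hρ'⟩ := h'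
  obtain rfl : B = B' := funext fun i => (hB i).unique (hB' i)
  ext1 τ
  exact Units.ext (matrix_eq_of_sum_smul_eq hli fun i => by rw [← hρ, ← hρ'])

theorem exists_monodromyRep {m : ℕ} (hm : 1 ≤ m) (c : ℂ) :
    ∃ ρ : LoopGroup →* GL (Fin (m + 1)) ℂ, ∀ τ i, translate τ (coverBasis m c i) =
      ∑ j, ((ρ τ : GL (Fin (m + 1)) ℂ) : Matrix (Fin (m + 1)) (Fin (m + 1)) ℂ) i j •
        coverBasis m c j :=
  exists_representation (linearIndependent_coverBasis hm c) fun τ => by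
    obtain ⟨n, a, h⟩ := exists_transport_loop_eq c τ
    exact ⟨_, translate_coverBasis hm h⟩

/-- The monodromy representation on the functions `Li_m, b_{m-1}, …, b_0`. -/
def monodromyRep {m : ℕ} (hm : 1 ≤ m) (c : ℂ) : LoopGroup →* GL (Fin (m + 1)) ℂ :=
  (exists_monodromyRep hm c).choose

theorem translate_coverBasis_eq_monodromyRep {m : ℕ} (hm : 1 ≤ m) (c : ℂ) (τ : LoopGroup)
    (i : Fin (m + 1)) : translate τ (coverBasis m c i) =
      ∑ j, ((monodromyRep hm c τ : GL (Fin (m + 1)) ℂ) :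
        Matrix (Fin (m + 1)) (Fin (m + 1)) ℂ) i j • coverBasis m c j :=
  (exists_monodromyRep hm c).choose_spec τ i

theorem monodromyRep_eq {m : ℕ} (hm : 1 ≤ m) {c ω : ℂ} {a : ℕ → ℂ} {τ : LoopGroup}
    (h : transport c (loop τ) (baseState c) = act c ω a (baseState c)) :
    ((monodromyRep hm c τ : GL (Fin (m + 1)) ℂ) : Matrix (Fin (m + 1)) (Fin (m + 1)) ℂ) =
      actMatrix m c ω a :=
  matrix_eq_of_sum_smul_eq (linearIndependent_coverBasis hm c) fun i => by
    rw [← translate_coverBasis_eq_monodromyRep, translate_coverBasis hm h]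

theorem isMonodromyRep_modifiedBasis {m : ℕ} (hm : 1 ≤ m) (k : ℕ) :
    IsMonodromyRep (modifiedBasis m k) (monodromyRep hm (-(k : ℂ))) :=
  ⟨coverBasis m (-(k : ℂ)), isContinuation_modifiedBasis hm k, linearIndependent_coverBasis hm _,
    translate_coverBasis_eq_monodromyRep hm _⟩

theorem isMonodromyRep_generalBasis {m : ℕ} (hm : 1 ≤ m) {c : ℂ} (hc : ∀ l : ℕ, c ≠ -(l : ℂ)) :
    IsMonodromyRep (generalBasis m c) (monodromyRep hm c) :=
  ⟨coverBasis m c, isContinuation_generalBasis hm hc, linearIndependent_coverBasis hm _,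
    translate_coverBasis_eq_monodromyRep hm _⟩

/-! ### Unipotence, the two matrices and the jump -/

theorem exp_one_add_natCast_mul (k : ℕ) (n : ℤ) :
    Complex.exp ((1 - -(k : ℂ)) * (n * (2 * Real.pi * Complex.I))) = 1 := by
  rw [show (1 - -(k : ℂ)) * (n * (2 * Real.pi * Complex.I)) =
    (((1 + k) * n : ℤ) : ℂ) * (2 * Real.pi * Complex.I) by push_cast; ring,
    Complex.exp_int_mul_two_pi_mul_I]

theorem isNilpotent_of_strictlyUpper {n : ℕ} {N : Matrix (Fin n) (Fin n) ℂ}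
    (h : ∀ i j, j ≤ i → N i j = 0) : IsNilpotent N := by
  refine ⟨n, ?_⟩
  -- The Cayley–Hamilton theorem then gives `N ^ n = 0`.
  have h1 : N.charpoly = Polynomial.X ^ n := by
    rw [Matrix.charpoly_of_isUpperTriangular N fun i j hij => h i j (le_of_lt hij)]
    simp [h _ _ le_rfl]
  have h2 := N.aeval_self_charpoly
  rw [h1] at h2
  simpa using h2

theorem isUnipotentSubgroup_range {m : ℕ} (hm : 1 ≤ m) (k : ℕ) :
    IsUnipotentSubgroup (monodromyRep hm (-(k : ℂ))).range := by
  rintro _ ⟨τ, rfl⟩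
  obtain ⟨n, a, h⟩ := exists_transport_loop_eq (-(k : ℂ)) τ
  rw [monodromyRep_eq hm h]
  refine isNilpotent_of_strictlyUpper fun i j hij => ?_
  rw [Matrix.sub_apply, sub_eq_zero]
  simp only [actMatrix, Matrix.of_apply, exp_one_add_natCast_mul, one_mul]
  rcases hij.eq_or_lt with rfl | hlt
  · by_cases hj : j = 0 <;> simp [hj]
  · have h0 : i ≠ 0 := by
      rintro rfl
      exact absurd hlt (Fin.not_lt_zero j)
    rw [if_neg h0, if_neg (not_le.mpr hlt), Matrix.one_apply_ne hlt.ne']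

theorem monodromyRep_Z0 {m : ℕ} (hm : 1 ≤ m) (k : ℕ) :
    ((monodromyRep hm (-(k : ℂ)) Z0 : GL (Fin (m + 1)) ℂ) :
      Matrix (Fin (m + 1)) (Fin (m + 1)) ℂ) = matrixZ0 m := by
  rw [monodromyRep_eq hm (transport_Z0 _)]
  have h := exp_one_add_natCast_mul k 1
  rw [Int.cast_one, one_mul] at h
  ext i j
  simp only [actMatrix, matrixZ0, Matrix.of_apply, h, eps_neg_natCast, one_mul]
  by_cases hi : i = 0
  · subst hi
    by_cases hj : j = 0
    · subst hj; simp
    · have : (j : ℕ) - 1 + 1 = j := by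
        have : (j : ℕ) ≠ 0 := fun h => hj (Fin.ext h)
        omega
      simp [hj, this]
  · simp [hi]

theorem monodromyRep_Z1 {m : ℕ} (hm : 1 ≤ m) (c : ℂ) :
    ((monodromyRep hm c Z1 : GL (Fin (m + 1)) ℂ) :
      Matrix (Fin (m + 1)) (Fin (m + 1)) ℂ) = matrixZ1 m := by
  rw [monodromyRep_eq hm (transport_Z1 _)]
  ext i j
  simp only [actMatrix, matrixZ1, Matrix.of_apply, mul_zero, Complex.exp_zero, one_mul]
  by_cases hi : i = 0
  · subst hi
    by_cases hj : j = 0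
    · subst hj; simp
    · have h1 : (j : ℕ) ≠ 0 := fun h => hj (Fin.ext h)
      have h2 : (j : ℕ) - 1 = 0 ↔ (j : ℕ) = 1 := by omega
      simp [hj, Ne.symm hj, h2]
  · have h0 : (i : ℕ) ≠ 0 := fun h => hi (Fin.ext h)
    rw [if_neg hi]
    rcases lt_trichotomy i j with h | h | h
    · have : (j : ℕ) - i ≠ 0 := by have := Fin.lt_def.mp h; omega
      simp [h.le, h.ne, h0, zero_pow this]
    · subst h; simp
    · simp [not_le.mpr h, h.ne', h0]

/-- The open disc of radius `1` around `-k` contains no other integer. -/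
theorem eventually_eps_eq_zero (k : ℕ) : ∀ᶠ c in 𝓝[≠] (-(k : ℂ)), eps c = 0 := by
  filter_upwards [self_mem_nhdsWithin,
    mem_nhdsWithin_of_mem_nhds (Metric.ball_mem_nhds (-(k : ℂ)) one_pos)] with c hc hb
  refine eps_of_forall_ne fun l hl => hc ?_
  rw [hl, mem_ball_iff_norm, show (-(l : ℂ) - -(k : ℂ)) = ((k - l : ℤ) : ℂ) by push_cast; ring,
    Complex.norm_intCast] at hb
  have h1 : |(k - l : ℤ)| < 1 := by exact_mod_cast hb
  rw [Int.abs_lt_one_iff] at h1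
  have : k = l := by omega
  rw [hl, this]
  exact Set.mem_singleton _

theorem continuous_actMatrix (m : ℕ) (ω : ℂ) (a : ℕ → ℂ) :
    Continuous fun c => actMatrix m c ω a := by
  refine continuous_matrix fun i j => ?_
  simp only [actMatrix, Matrix.of_apply]
  split_ifs <;> fun_prop

/-- Near `-k` the coefficients `a` vanish together with `eps c`, and what is left of the matrix is
continuous in `c`. -/
theorem tendsto_monodromyRep_Z0 {m : ℕ} (hm : 1 ≤ m) (k : ℕ) :
    Tendsto (fun c : ℂ => ((monodromyRep hm c Z0 : GL (Fin (m + 1)) ℂ) :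
      Matrix (Fin (m + 1)) (Fin (m + 1)) ℂ)) (𝓝[≠] (-(k : ℂ)))
      (𝓝 (actMatrix m (-(k : ℂ)) (2 * Real.pi * Complex.I) 0)) := by
  refine (((continuous_actMatrix m (2 * Real.pi * Complex.I) 0).tendsto _).mono_left
    nhdsWithin_le_nhds).congr' ?_
  filter_upwards [eventually_eps_eq_zero k] with c hc
  rw [monodromyRep_eq hm (transport_Z0 c), hc]
  simp only [zero_mul]
  rfl

theorem actMatrix_ne_matrixZ0 {m : ℕ} (hm : 1 ≤ m) (c ω : ℂ) :
    actMatrix m c ω 0 ≠ matrixZ0 m := by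
  intro h
  -- The entry in row `0`, column `1` is `0` in the limit but `2 π i` in `matrixZ0`.
  have h1 := congrFun (congrFun h 0) ⟨1, by omega⟩
  have h2 : (⟨1, by omega⟩ : Fin (m + 1)) ≠ 0 := fun h => one_ne_zero (congrArg Fin.val h)
  simp only [actMatrix, matrixZ0, Matrix.of_apply, if_true, if_neg h2, Pi.zero_apply, mul_zero,
    if_pos (Fin.zero_le _)] at h1
  simp [Real.pi_ne_zero] at h1

end

end PolylogMonodromy

theorem theorem2p10 (m k : ℕ) (hm : 1 ≤ m) :
    ∃ ρ : PolylogMonodromy.LoopGroup →* GL (Fin (m + 1)) ℂ,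
      -- `ρ` is the monodromy representation on the modified basis
      PolylogMonodromy.IsMonodromyRep (PolylogMonodromy.modifiedBasis m k) ρ ∧
      (∀ ρ' : PolylogMonodromy.LoopGroup →* GL (Fin (m + 1)) ℂ,
        PolylogMonodromy.IsMonodromyRep (PolylogMonodromy.modifiedBasis m k) ρ' → ρ' = ρ) ∧
      ((ρ PolylogMonodromy.Z0 : GL (Fin (m + 1)) ℂ) : Matrix (Fin (m + 1)) (Fin (m + 1)) ℂ) =
        PolylogMonodromy.matrixZ0 m ∧
      ((ρ PolylogMonodromy.Z1 : GL (Fin (m + 1)) ℂ) : Matrix (Fin (m + 1)) (Fin (m + 1)) ℂ) =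
        PolylogMonodromy.matrixZ1 m ∧
      PolylogMonodromy.IsUnipotentSubgroup ρ.range ∧
      -- the jump: the matrices of `Z₀` at nonsingular `c` have a different limit as `c → -k`
      ∃ σ : ℂ → (PolylogMonodromy.LoopGroup →* GL (Fin (m + 1)) ℂ),
        (∀ c : ℂ, (∀ l : ℕ, c ≠ -(l : ℂ)) →
          PolylogMonodromy.IsMonodromyRep (PolylogMonodromy.generalBasis m c) (σ c) ∧
          ∀ σ' : PolylogMonodromy.LoopGroup →* GL (Fin (m + 1)) ℂ,
            PolylogMonodromy.IsMonodromyRep (PolylogMonodromy.generalBasis m c) σ' → σ' = σ c) ∧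
        ∃ L : Matrix (Fin (m + 1)) (Fin (m + 1)) ℂ,
          Tendsto
            (fun c : ℂ => ((σ c PolylogMonodromy.Z0 : GL (Fin (m + 1)) ℂ) :
              Matrix (Fin (m + 1)) (Fin (m + 1)) ℂ))
            (𝓝[≠] (-(k : ℂ))) (𝓝 L) ∧
          L ≠ ((ρ PolylogMonodromy.Z0 : GL (Fin (m + 1)) ℂ) :
            Matrix (Fin (m + 1)) (Fin (m + 1)) ℂ) := by
  have hk := PolylogMonodromy.isMonodromyRep_modifiedBasis hm k
  refine ⟨PolylogMonodromy.monodromyRep hm (-(k : ℂ)), hk, fun ρ' h => h.unique hk,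
    PolylogMonodromy.monodromyRep_Z0 hm k, PolylogMonodromy.monodromyRep_Z1 hm _,
    PolylogMonodromy.isUnipotentSubgroup_range hm k, PolylogMonodromy.monodromyRep hm,
    fun c hc => ?_, _, PolylogMonodromy.tendsto_monodromyRep_Z0 hm k, ?_⟩
  · have h := PolylogMonodromy.isMonodromyRep_generalBasis hm hc
    exact ⟨h, fun σ' h' => h'.unique h⟩
  · rw [PolylogMonodromy.monodromyRep_Z0 hm k]
    exact PolylogMonodromy.actMatrix_ne_matrixZ0 hm _ _
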